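/- Let $p$ be an odd prime, $m>2$ an integer, $r=p^m$, $\mathrm{Tr}$ the trace from $\mathbb F_r$ to $\mathbb F_p$, and $\eta$ the quadratic character of $\mathbb F_p$ with $\eta(0)=0$. Write $m_p\in\mathbb F_p$ for the residue of $m$ modulo $p$. Put $$D=\{x\in\mathbb F_r:\mathrm{Tr}(x)=1,\ \mathrm{Tr}(x^2)=0\},\qquad C_D=\{(\mathrm{Tr}(ax))_{x\in D}:a\in\mathbb F_r\}\subseteq\mathbb F_p^{D}.$$ "Parameters $[n,m]$" means length $n=\#D$ and dimension $m$ over $\mathbb F_p$. For a codeword and $\rho\in\mathbb F_p$ let $N_\rho$ be the number of its components equal to $\rho$, so that $N_0=n-\sum_{\rho\ne0}N_\rho$. The complete weight enumerator of $C_D$ is the polynomial $\sum_{\mathsf c\in C_D}\prod_{\rho\in\mathbb F_p}z_\rho^{N_\rho(\mathsf c)}$. In each case below it is the sum of the monomials $\prod_{\rho\in\mathbb F_p} z_\rho^{N_\rho}$ of the listed patterns $(N_\rho)_{\rho\in\mathbb F_p^*}$, each multiplied by its listed frequency (if two listed patterns coincide, their frequencies add up). Always $\rho_0$ runs through $\mathbb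 F_p^*$, $\{\rho_0,\rho_1\}$ runs through the two-element subsets of $\mathbb F_p^*$, $\Delta$ runs through the elements of $\mathbb F_p^*$ with $\eta(\Delta)=-1$, and the frequency is that of each single pattern of the family. For $m$ even put $\varepsilon=(-1)^{(p-1)m/4}$; for $m$ odd put $\varepsilon=(-1)^{(p-1)(m+1)/4}$. (1) If $2\mid m$ and $m_p=0$, then $C_D$ has parameters $[p^{m-2},m]$, and the patterns are: - $N_\rho=0$ for all $\rho\neq 0$: once; - $N_\rho=p^{m-3}$ for all $\rho\neq 0$: $p^{m-1}-p$ times; - $N_\rho=p^{m-3}+\varepsilon p^{\frac{m-4}2}$ for all $\rho\neq 0$: $(p-1)p^{m-2}$ times; - $N_{\rho_0}=p^{m-2}$ and $N_\rho=0$ for $\rho\ne\rho_0$: once for each $\rho_0$; - $N_{\rho_0}=p^{m-3}-(p-1)\varepsilon p^{\frac{m-4}2}$ and $N_\rho=p^{m-3}+\varepsilon p^{\frac{m-4}2}$ for $\rho\neq\rho_0$: $(p-1)p^{m-2}$ times for each $\rho_0$. (2) If $2\mid m$ and $m_p\ne0$, then $C_D$ has parameters $[n,m]$ with $n=p^{m-2}-\varepsilon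 p^{\frac{m-2}2}$, and the patterns are: - $N_\rho=0$ for all $\rho\neq 0$: once; - $N_\rho=p^{m-3}$ for all $\rho\neq 0$: $p^{m-2}-1$ times; - $N_\rho=p^{m-3}-\varepsilon p^{\frac{m-4}2}$ for all $\rho\neq 0$: $\frac{p-1}2\left(p^{m-1}+\varepsilon p^{\frac m2}\right)$ times; - $N_{\rho_0}=n$ and $N_\rho=0$ for $\rho\ne\rho_0$: once for each $\rho_0$; - $N_{\rho_0}=p^{m-3}-\varepsilon p^{\frac{m-2}2}$ and $N_\rho=p^{m-3}$ for $\rho\ne\rho_0$: $p^{m-2}-1$ times for each $\rho_0$; - $N_{\rho_0}=p^{m-3}-(p-1)\varepsilon p^{\frac{m-4}2}$ and $N_\rho=p^{m-3}+\varepsilon p^{\frac{m-4}2}$ for $\rho\ne\rho_0$: $n$ times for each $\rho_0$; - $N_{\rho_0}=N_{\rho_1}=p^{m-3}-(p-1)\varepsilon p^{\frac{m-4}2}$ and $N_\rho=p^{m-3}+\varepsilon p^{\frac{m-4}2}$ for $\rho\ne\rho_0,\rho_1$: $n$ times for each $\{\rho_0,\rho_1\}$. (3) If $2\nmid m$ and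 $m_p=0$, then $C_D$ has parameters $[p^{m-2},m]$, and the patterns are: - $N_\rho=0$ for all $\rho\neq 0$: once; - $N_\rho=p^{m-3}$ for all $\rho\neq 0$: $p^{m-1}-p$ times; - $N_\rho=p^{m-3}+\eta(\rho)\varepsilon p^{\frac{m-3}2}$ for all $\rho\neq 0$: $\frac12(p-1)p^{m-2}$ times; - $N_\rho=p^{m-3}-\eta(\rho)\varepsilon p^{\frac{m-3}2}$ for all $\rho\neq 0$: $\frac12(p-1)p^{m-2}$ times; - $N_{\rho_0}=p^{m-2}$ and $N_\rho=0$ for $\rho\ne\rho_0$: once for each $\rho_0$; - $N_{\rho_0}=p^{m-3}$ and $N_\rho=p^{m-3}+\eta(\rho-\rho_0)\varepsilon p^{\frac{m-3}2}$ for $\rho\ne\rho_0$: $\frac12(p-1)p^{m-2}$ times for each $\rho_0$; - $N_{\rho_0}=p^{m-3}$ and $N_\rho=p^{m-3}-\eta(\rho-\rho_0)\varepsilon p^{\frac{m-3}2}$ for $\rho\ne\rho_0$: $\frac12(p-1)p^{m-2}$ times for each $\rho_0$. (4) If $2\nmid m$ and $m_p\ne0$, then $C_D$ has parameters $[n,m]$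 with $n=p^{m-2}-\eta(-m_p)\varepsilon p^{\frac{m-3}2}$, and the patterns are: - $N_\rho=0$ for all $\rho\neq 0$: once; - $N_\rho=p^{m-3}$ for all $\rho\neq 0$: $n+\eta(-m_p)\varepsilon p^{\frac{m-1}2}-1$ times; - $N_{\rho_0}=n$ and $N_\rho=0$ for $\rho\ne\rho_0$: once for each $\rho_0$; - $N_{\rho_0}=p^{m-3}$ and $N_\rho=p^{m-3}+\eta(-m_p)\eta(\rho^2-\rho\rho_0)\varepsilon p^{\frac{m-3}2}$ for $\rho\ne\rho_0$: $n$ times for each $\rho_0$; - $N_{\rho_0}=p^{m-3}-\eta(-m_p)\varepsilon p^{\frac{m-3}2}$ and $N_\rho=p^{m-3}$ for $\rho\ne\rho_0$: $n+\eta(-m_p)\varepsilon p^{\frac{m-1}2}-1$ times for each $\rho_0$; - $N_{\rho_0}=N_{\rho_1}=p^{m-3}$ and $N_\rho=p^{m-3}+\eta\bigl(-m_p(\rho-\rho_0)(\rho-\rho_1)\bigr)\varepsilon p^{\frac{m-3}2}$ for $\rho\ne\rho_0,\rho_1$: $n$ times for each $\{\rho_0,\rho_1\}$; - $N_\rho=p^{m-3}+\eta(-m_p)\eta(m_p^2\rho^2-\Delta)\varepsilon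 p^{\frac{m-3}2}$ for all $\rho\neq 0$: $n$ times for each $\Delta$; - $N_{\rho_0}=p^{m-3}-\eta(m_p)\varepsilon p^{\frac{m-3}2}$ and $N_\rho=p^{m-3}+\eta(-m_p)\eta\bigl(m_p^2(\rho-\rho_0)^2-\Delta\bigr)\varepsilon p^{\frac{m-3}2}$ for $\rho\ne\rho_0$: $n$ times for each pair $(\rho_0,\Delta)$. -/

import Mathlib

open Finset

section Codes

variable {p : ℕ} [Fact p.Prime] {ι : Type*} [Fintype ι]

/-- `C` is an `[n, k]` linear code: a `k`-dimensional subspace of `𝔽_p ^ n`. -/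
def HasParameters (C : Submodule (ZMod p) (ι → ZMod p)) (n k : ℕ) : Prop :=
  Fintype.card ι = n ∧ Module.finrank (ZMod p) C = k

/-- The composition of a vector: `composition v z` is the number of components of `v` equal to `z`. -/
def composition (v : ι → ZMod p) (z : ZMod p) : ℕ :=
  #{i | v i = z}

/-- The complete weight enumerator `∑_{c ∈ C} ∏_{z ∈ 𝔽_p} z ^ (composition c z)`, with one variable
for each element of `𝔽_p`. -/
noncomputable def completeWeightEnumerator (C : Submodule (ZMod p) (ι → ZMod p)) :
    MvPolynomial (ZMod p) ℤ :=
  ∑ c ∈ (C : Set (ι → ZMod p)).toFinite.toFinset, ∏ z, MvPolynomial.X z ^ composition c z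

/-- The monomial of a codeword of length `n` in which every nonzero symbol `ρ` occurs `N ρ` times
(the value `N 0` is not used), so that the symbol `0` occurs `n - ∑_{ρ ≠ 0} N ρ` times.
The exponents are integers written as natural numbers; if one of them were negative, the monomial
would have degree greater than `n` and could not occur in an enumerator of a code of length `n`. -/
noncomputable def patternMonomial (n : ℤ) (N : ZMod p → ℤ) : MvPolynomial (ZMod p) ℤ :=
  MvPolynomial.X 0 ^ (n - ∑ ρ with ρ ≠ 0, N ρ).toNat *
    ∏ ρ with ρ ≠ 0, MvPolynomial.X ρ ^ (N ρ).toNat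

end Codes

section DefiningSet

variable (p : ℕ) [Fact p.Prime] {F : Type*} [Field F] [Algebra (ZMod p) F]

/-- The linear map `a ↦ (Tr (a x))_{x ∈ D}`. -/
noncomputable def traceMap (D : Finset F) : F →ₗ[ZMod p] (D → ZMod p) :=
  LinearMap.pi fun x => Algebra.trace (ZMod p) F ∘ₗ LinearMap.mulRight (ZMod p) (x : F)

/-- The code `C_D = {(Tr (a x))_{x ∈ D} : a ∈ F}`. -/
noncomputable def traceCode (D : Finset F) : Submodule (ZMod p) (D → ZMod p) :=
  LinearMap.range (traceMap p D)

theorem mem_traceCode (D : Finset F) (c : D → ZMod p) :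
    c ∈ traceCode p D ↔ ∃ a : F, c = fun x : D => Algebra.trace (ZMod p) F (a * x) := by
  constructor
  · rintro ⟨a, rfl⟩
    exact ⟨a, rfl⟩
  · rintro ⟨a, rfl⟩
    exact ⟨a, rfl⟩

/-- The defining set `D = {x ∈ F : Tr x = 1, Tr (x ^ 2) = 0}`. -/
noncomputable def definingSet (F : Type*) [Field F] [Fintype F] [Algebra (ZMod p) F] : Finset F :=
  {x | Algebra.trace (ZMod p) F x = 1 ∧ Algebra.trace (ZMod p) F (x ^ 2) = 0}

end DefiningSet

/-! Write q for the order of the base field K, m for the degree of the extension L, μ for m in K, η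
for the quadratic character and G for its Gauss sum. Everything reduces to one count: the points of
the quadric Tr(x²) = t on an affine subspace given by equations Tr(l(u)x) = c(u), with l injective
(`card_quadric_section`). Expanding in additive characters and completing the square in x leaves the
sums of ψ(w Tr(x²)), which equal η(w)^m (-1)^(m-1) G^m by `sum_addChar_mul_trace_sq`. The sign is η
of the discriminant of the trace form, a square exactly when m is odd (`isSquare_discr_iff_odd`).

With the line spanned by 1 the formula gives the number of a with prescribed s = Tr a and t =
Tr(a²); with the plane spanned by 1 and some a outside K it gives the number N_ρ of components of
the codeword of a equal to ρ. Since G² = η(-1)q, the remaining sum counts zeros of a polynomial of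
degree at most two when m is even, and adds up its values under η when m is odd. So N_ρ depends on a
only through s and t.

If μ = 0, that polynomial is linear in one variable. For s = 0 the pattern is constant; for s ≠ 0 it
is governed by the centre ρ₀ = t/(2s). If μ ≠ 0, put c = s/μ and Δ = s² - μt: the pattern is
governed by the zeros and the values under η of μ²(ρ - c)² - Δ. Then Δ = 0 gives one exceptional
symbol, a nonzero square Δ gives the two-element set of roots, and a nonsquare gives no root. A root
0 is invisible in a pattern, which splits each family in two.

The scalars a = c give the constant codewords, because Tr x = 1 on D; they are removed from the
fibres of (s, t). The map from a to its codeword is injective because N₀ < n outside K, so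
frequencies of codewords are frequencies of a, and the dimension is m. -/

/-! ### Root counts and character sums of quadratic polynomials in one variable. -/

section QuadraticSums

/-- Completing the square is a change of variable on a finite field of odd characteristic. -/
theorem bijective_two_mul_mul_add {K : Type*} [Field K] [Finite K]
    (hK : ringChar K ≠ 2) {A : K} (hA : A ≠ 0) (B : K) :
    Function.Bijective fun v : K => 2 * A * v + B := by
  have h2 := Ring.two_ne_zero hK
  refine Finite.injective_iff_bijective.1 fun x y h => ?_
  have : 2 * A * x = 2 * A * y := add_right_cancel h
  exact mul_left_cancel₀ (mul_ne_zero h2 hA) this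

variable {K : Type*} [Field K] [Fintype K] [DecidableEq K]

theorem card_sq_eq (hK : ringChar K ≠ 2) (a : K) :
    (#{x : K | x ^ 2 = a} : ℤ) = quadraticChar K a + 1 := by
  rw [← quadraticChar_card_sqrts hK a]
  congr 2
  ext x
  simp

theorem card_quadratic_roots (hK : ringChar K ≠ 2) {A : K} (hA : A ≠ 0) (B C : K) :
    (#{v : K | A * v ^ 2 + B * v + C = 0} : ℤ) = quadraticChar K (B ^ 2 - 4 * A * C) + 1 := by
  have h2 := Ring.two_ne_zero hK
  rw [← card_sq_eq hK]
  congr 1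
  refine card_bijective _ (bijective_two_mul_mul_add hK hA B) fun v => ?_
  simp only [mem_filter, mem_univ, true_and]
  have h4 : (4 : K) ≠ 0 := by
    have : (4 : K) = 2 * 2 := by norm_num
    rw [this]; exact mul_ne_zero h2 h2
  constructor
  · intro h
    linear_combination 4 * A * h
  · intro h
    refine (mul_eq_zero.1 (?_ : 4 * A * (A * v ^ 2 + B * v + C) = 0)).resolve_left
      (mul_ne_zero h4 hA)
    linear_combination h

theorem card_mul_eq {D : K} (hD : D ≠ 0) :
    #{x : K × K | x.1 * x.2 = D} = Fintype.card K - 1 := by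
  have : #{x : K × K | x.1 * x.2 = D} = #((univ : Finset K).erase 0) := by
    refine card_bij' (fun x _ => x.1) (fun y _ => (y, D / y)) ?_ ?_ ?_ ?_
    · rintro ⟨x, y⟩ h
      simp only [mem_filter, mem_univ, true_and, mem_erase, ne_eq, and_true] at h ⊢
      rintro rfl
      simp [eq_comm, hD] at h
    · intro y hy
      simp only [mem_filter, mem_univ, true_and, mem_erase, ne_eq, and_true] at hy ⊢
      field_simp
    · rintro ⟨x, y⟩ h
      simp only [mem_filter, mem_univ, true_and] at h
      have hx : x ≠ 0 := by rintro rfl; simp [eq_comm, hD] at h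
      simp [← h, hx]
    · simp
  rw [this, card_erase_of_mem (mem_univ _), card_univ]

/-- For D ≠ 0, adding 1 to each term turns the sum into the number of points of the hyperbola y² -
x² = D, which factors as (y - x)(y + x) = D and so has q - 1 points. -/
theorem sum_quadraticChar_sq_sub (hK : ringChar K ≠ 2) (D : K) :
    ∑ y : K, quadraticChar K (y ^ 2 - D) = if D = 0 then (Fintype.card K : ℤ) - 1 else -1 := by
  have h2 := Ring.two_ne_zero hK
  split_ifs with hD
  · subst hD
    have h : ∀ y : K, quadraticChar K (y ^ 2 - 0) = if y = 0 then 0 else 1 := by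
      intro y
      split_ifs with hy
      · simp [hy]
      · rw [sub_zero, quadraticChar_sq_one' hy]
    have hc := card_erase_of_mem (mem_univ (0 : K))
    rw [sum_congr rfl fun y _ => h y, sum_ite]
    rw [card_univ] at hc
    have h1 : 1 ≤ Fintype.card K := Fintype.card_pos
    have : ({x | ¬ x = 0} : Finset K) = univ.erase 0 := by ext; simp
    rw [this]
    simp [hc, h1]
  · have h : ∑ y : K, (quadraticChar K (y ^ 2 - D) + 1) = (Fintype.card K : ℤ) - 1 := by
      have h1 : 1 ≤ Fintype.card K := Fintype.card_pos
      have e := card_mul_eq hD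
      have : #{x : K × K | x.1 * x.2 = D} = #{x : K × K | x.2 ^ 2 = x.1 ^ 2 - D} := by
        refine (card_bijective (fun x : K × K => (x.1 - x.2, x.1 + x.2)) ?_ fun x => ?_).symm
        · refine Finite.injective_iff_bijective.1 fun x y h => ?_
          simp only [Prod.mk.injEq] at h
          obtain ⟨ha, hb⟩ := h
          refine Prod.ext (mul_left_cancel₀ h2 ?_) (mul_left_cancel₀ h2 ?_)
          · linear_combination ha + hb
          · linear_combination hb - ha
        · simp only [mem_filter, mem_univ, true_and]
          constructor <;> intro h <;> linear_combination -h
      rw [this, card_filter, Fintype.sum_prod_type] at e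
      simp only [← card_filter] at e
      rw [sum_congr rfl fun y _ => (card_sq_eq hK (y ^ 2 - D)).symm, ← Nat.cast_sum, e]
      push_cast [h1]
      rfl
    rw [sum_add_distrib] at h
    simp only [sum_const, card_univ, nsmul_eq_mul, mul_one] at h
    linarith

/-- Multiplication by 4A completes the square; it costs the factor η(4A) = η(A), which is its own
inverse. -/
theorem sum_quadraticChar_quadratic (hK : ringChar K ≠ 2) {A : K} (hA : A ≠ 0) (B C : K) :
    ∑ v : K, quadraticChar K (A * v ^ 2 + B * v + C) =
      quadraticChar K A * if B ^ 2 - 4 * A * C = 0 then (Fintype.card K : ℤ) - 1 else -1 := by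
  have h2 := Ring.two_ne_zero hK
  have hA2 := quadraticChar_sq_one hA
  have h4 : quadraticChar K 4 = 1 := by
    have : (4 : K) = 2 ^ 2 := by norm_num
    rw [this, quadraticChar_sq_one' h2]
  rw [← sum_quadraticChar_sq_sub hK, ← (bijective_two_mul_mul_add hK hA B).sum_comp
    fun y => quadraticChar K (y ^ 2 - (B ^ 2 - 4 * A * C)), mul_sum]
  refine sum_congr rfl fun v _ => ?_
  have : (2 * A * v + B) ^ 2 - (B ^ 2 - 4 * A * C) = 4 * A * (A * v ^ 2 + B * v + C) := by ring
  rw [this, map_mul, map_mul, h4, one_mul, ← mul_assoc, ← sq, hA2, one_mul]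

end QuadraticSums

/-! ### The discriminant of an extension of finite fields modulo squares. -/

section Discriminant

variable (K L : Type*) [Field K] [Field L] [Finite L] [Algebra K L]

/-- The conjugates of the family `b`, one row for each power of the Frobenius automorphism. -/
noncomputable def frobeniusMatrix {n : ℕ} (b : Fin n → L) : Matrix (Fin n) (Fin n) L :=
  Matrix.of fun i j => b j ^ Nat.card K ^ (i : ℕ)

variable {K L}

theorem transpose_frobeniusMatrix_mul_self {n : ℕ} (hn : Module.finrank K L = n) (b : Fin n → L) :
    (frobeniusMatrix K L b).transpose * frobeniusMatrix K L b =
      (Algebra.traceMatrix K b).map (algebraMap K L) := by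
  ext i j
  rw [Matrix.mul_apply, Matrix.map_apply, Algebra.traceMatrix_apply, Algebra.traceForm_apply,
    FiniteField.algebraMap_trace_eq_sum_pow, hn, sum_range]
  simp [frobeniusMatrix, mul_pow]

theorem det_frobeniusMatrix_sq {n : ℕ} (hn : Module.finrank K L = n) (b : Fin n → L) :
    (frobeniusMatrix K L b).det ^ 2 = algebraMap K L (Algebra.discr K b) := by
  have h := congrArg Matrix.det (transpose_frobeniusMatrix_mul_self hn b)
  rw [Matrix.det_mul, Matrix.det_transpose, ← sq] at h
  rw [h, Algebra.discr_def, RingHom.map_det]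
  rfl

theorem pow_card_pow_finrank (x : L) : x ^ Nat.card K ^ Module.finrank K L = x := by
  rw [← Module.natCard_eq_pow_finrank (K := K) (V := L)]
  have := Fintype.ofFinite L
  rw [Nat.card_eq_fintype_card, FiniteField.pow_card]

variable [Finite K]

/-- Frobenius sends each row to the next one and the last row back to the first, so it multiplies
the determinant by the sign of an n-cycle. -/
theorem det_frobeniusMatrix_pow_card {n : ℕ} (hn : Module.finrank K L = n) (b : Fin n → L) :
    (frobeniusMatrix K L b).det ^ Nat.card K = (-1) ^ (n - 1) * (frobeniusMatrix K L b).det := by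
  have := Fintype.ofFinite K
  obtain ⟨k, rfl⟩ : ∃ k, n = k + 1 :=
    Nat.exists_eq_succ_of_ne_zero (hn ▸ Module.finrank_pos.ne')
  have h : (frobeniusMatrix K L b).det ^ Nat.card K =
      FiniteField.frobeniusAlgHom K L (frobeniusMatrix K L b).det := by
    rw [FiniteField.coe_frobeniusAlgHom, Nat.card_eq_fintype_card]
  have h' : (frobeniusMatrix K L b).map (FiniteField.frobeniusAlgHom K L) =
      (frobeniusMatrix K L b).submatrix (finRotate (k + 1)) id := by
    ext i j
    simp only [Matrix.map_apply, frobeniusMatrix, Matrix.of_apply, Matrix.submatrix_apply, id,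
      FiniteField.coe_frobeniusAlgHom, ← Nat.card_eq_fintype_card]
    rw [← pow_mul, ← pow_succ]
    rcases eq_or_ne i (Fin.last k) with rfl | hi
    · simp only [Fin.val_last, finRotate_last, Fin.val_zero, pow_zero, pow_one]
      rw [← hn, pow_card_pow_finrank]
    · rw [coe_finRotate_of_ne_last hi]
  rw [h, AlgHom.map_det, AlgHom.mapMatrix_apply, h', Matrix.det_permute, sign_finRotate]
  simp

/-- The Galois group consists of the powers of Frobenius, so an element fixed by Frobenius is fixed
by all of it. -/
theorem mem_range_algebraMap_of_pow_card_eq_self {x : L} (hx : x ^ Nat.card K = x) :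
    x ∈ Set.range (algebraMap K L) := by
  have := Fintype.ofFinite K
  refine (IsGalois.mem_range_algebraMap_iff_fixed (F := K) x).2 fun f => ?_
  obtain ⟨i, rfl⟩ := (FiniteField.bijective_frobeniusAlgEquivOfAlgebraic_pow K L).surjective f
  dsimp only
  induction (i : ℕ) with
  | zero => rfl
  | succ k ih =>
    rw [pow_succ, AlgEquiv.mul_apply, FiniteField.coe_frobeniusAlgEquivOfAlgebraic,
      ← Nat.card_eq_fintype_card]
    beta_reduce
    rw [hx, ih]

/-- The determinant d of the Frobenius matrix is a square root of the discriminant in L. The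
discriminant is a square in K iff d lies in K, that is iff d^q = d, and d^q = (-1)^(n-1) d. -/
theorem isSquare_discr_iff_odd (hK : ringChar K ≠ 2) {n : ℕ} (b : Module.Basis (Fin n) K L) :
    IsSquare (Algebra.discr K b) ↔ Odd n := by
  have := Fintype.ofFinite K
  have hn : Module.finrank K L = n := by rw [Module.finrank_eq_card_basis b, Fintype.card_fin]
  have hn0 : 0 < n := hn ▸ Module.finrank_pos
  have h2K := Ring.two_ne_zero hK
  set d := (frobeniusMatrix K L b).det with hd
  have hsq := det_frobeniusMatrix_sq hn b
  have hpow := det_frobeniusMatrix_pow_card hn b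
  rw [← hd] at hsq hpow
  have hd0 : d ≠ 0 := by
    intro h0
    rw [h0, zero_pow two_ne_zero, eq_comm, map_eq_zero] at hsq
    exact Algebra.discr_not_zero_of_basis K b hsq
  constructor
  · rintro ⟨e, he⟩
    have hde : d ^ 2 = (algebraMap K L e) ^ 2 := by rw [hsq, he, ← sq, map_pow]
    obtain ⟨f, hf⟩ : ∃ f : K, d = algebraMap K L f := by
      rcases sq_eq_sq_iff_eq_or_eq_neg.1 hde with h | h
      · exact ⟨e, h⟩
      · exact ⟨-e, by rw [h, map_neg]⟩
    have hfix : d ^ Nat.card K = d := by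
      rw [hf, ← map_pow, Nat.card_eq_fintype_card, FiniteField.pow_card]
    by_contra hodd
    have : Odd (n - 1) := by
      rw [Nat.not_odd_iff_even] at hodd
      exact Nat.Even.sub_odd hn0 hodd odd_one
    rw [hfix, this.neg_one_pow] at hpow
    have h2 : (2 : L) * d = 0 := by linear_combination hpow
    have h2L : (2 : L) ≠ 0 := by
      rw [← map_ofNat (algebraMap K L) 2]
      exact (map_ne_zero (algebraMap K L)).2 h2K
    exact (mul_ne_zero h2L hd0) h2
  · intro hodd
    have : Even (n - 1) := Nat.Odd.sub_odd hodd odd_one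
    rw [this.neg_one_pow, one_mul] at hpow
    obtain ⟨f, hf⟩ := mem_range_algebraMap_of_pow_card_eq_self (K := K) hpow
    refine ⟨f, (algebraMap K L).injective ?_⟩
    rw [← hsq, ← hf, map_mul, sq]

end Discriminant

/-! ### Quadratic Gauss sums and the exponential sum of the trace form. -/

section GaussSums

theorem AddChar.map_sum_eq_prod {A M ι : Type*} [AddCommMonoid A] [CommMonoid M] (ψ : AddChar A M)
    (s : Finset ι) (f : ι → A) : ψ (∑ i ∈ s, f i) = ∏ i ∈ s, ψ (f i) := by
  classical
  induction s using Finset.induction_on with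
  | empty => simp
  | insert a s ha ih => rw [sum_insert ha, prod_insert ha, AddChar.map_add_eq_mul, ih]

variable {K : Type*} [Field K] [Fintype K] [DecidableEq K]

/-- The Gauss sum of the quadratic character. -/
noncomputable def quadraticGaussSum (ψ : AddChar K ℂ) : ℂ :=
  gaussSum ((quadraticChar K).ringHomComp (Int.castRingHom ℂ)) ψ

theorem quadraticGaussSum_sq (hK : ringChar K ≠ 2) {ψ : AddChar K ℂ} (hψ : ψ.IsPrimitive) :
    quadraticGaussSum ψ ^ 2 = (quadraticChar K (-1) : ℂ) * Fintype.card K := by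
  have h := gaussSum_sq (χ := (quadraticChar K).ringHomComp (Int.castRingHom ℂ))
    (MulChar.ringHomComp_ne_one_iff (RingHom.injective_int _) |>.2 (quadraticChar_ne_one hK))
    ((quadraticChar_isQuadratic K).comp _) hψ
  exact h

theorem sum_quadraticChar_mul_addChar (hK : ringChar K ≠ 2) (ψ : AddChar K ℂ) (y : K) :
    ∑ w : K, (quadraticChar K w : ℂ) * ψ (w * y) = (quadraticChar K y : ℂ) * quadraticGaussSum ψ := by
  rcases eq_or_ne y 0 with rfl | hy
  · have h := quadraticChar_sum_zero hK
    simp only [mul_zero, AddChar.map_zero_eq_one, mul_one, quadraticChar_zero, Int.cast_zero,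
      zero_mul]
    exact_mod_cast h
  · have h := gaussSum_mulShift ((quadraticChar K).ringHomComp (Int.castRingHom ℂ)) ψ
      (Units.mk0 y hy)
    have h1 : ((quadraticChar K y : ℤ) : ℂ) ^ 2 = 1 := by
      exact_mod_cast quadraticChar_sq_one hy
    rw [quadraticGaussSum, ← h, MulChar.ringHomComp_apply, Units.val_mk0, eq_intCast, ← mul_assoc,
      ← sq, h1, one_mul, gaussSum]
    refine sum_congr rfl fun w _ => ?_
    rw [MulChar.ringHomComp_apply, eq_intCast, AddChar.mulShift_apply, mul_comm y]

theorem sum_addChar_mul_sq (hK : ringChar K ≠ 2) {ψ : AddChar K ℂ} (hψ : ψ.IsPrimitive) {b : K}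
    (hb : b ≠ 0) :
    ∑ x : K, ψ (b * x ^ 2) = (quadraticChar K b : ℂ) * quadraticGaussSum ψ := by
  -- Each y has η(y) + 1 square roots.
  have h1 : ∑ x : K, ψ (b * x ^ 2) = ∑ y : K, ((quadraticChar K y : ℂ) + 1) * ψ (y * b) := by
    rw [← sum_fiberwise univ (fun x : K => x ^ 2)]
    refine sum_congr rfl fun y _ => ?_
    have h := card_sq_eq hK y
    rw [sum_congr rfl (g := fun _ => ψ (y * b)), sum_const, nsmul_eq_mul]
    · congr 1
      exact_mod_cast h
    · intro x hx
      rw [← (mem_filter.1 hx).2, mul_comm]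
  simp only [h1, add_mul, one_mul, sum_add_distrib, sum_quadraticChar_mul_addChar hK]
  rw [AddChar.sum_mulShift b hψ, if_neg hb, Nat.cast_zero, add_zero]

theorem sum_ne_zero_addChar_mul {ψ : AddChar K ℂ} (hψ : ψ.IsPrimitive) (y : K) :
    ∑ w : K with w ≠ 0, ψ (w * y) = (if y = 0 then (Fintype.card K : ℂ) else 0) - 1 := by
  have h := AddChar.sum_mulShift y hψ
  rw [← sum_filter_add_sum_filter_not univ (fun w : K => w ≠ 0)] at h
  have h2 : ∑ w : K with ¬ w ≠ 0, ψ (w * y) = 1 := by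
    have : ({w | ¬ w ≠ 0} : Finset K) = {0} := by ext; simp
    rw [this, sum_singleton, zero_mul, AddChar.map_zero_eq_one]
  rw [h2] at h
  rw [eq_sub_iff_add_eq, h]
  split_ifs <;> simp

variable {L : Type*} [Field L] [Fintype L] [Algebra K L]

/-- In an orthogonal basis of the trace form the sum factors into one-variable Gauss sums. The
diagonal entries enter only through η of their product, the discriminant, and this is where the sign
(-1)^(m-1) comes from. -/
theorem sum_addChar_mul_trace_sq (hK : ringChar K ≠ 2) {ψ : AddChar K ℂ} (hψ : ψ.IsPrimitive)
    {w : K} (hw : w ≠ 0) :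
    ∑ x : L, ψ (w * Algebra.trace K L (x ^ 2)) =
      (quadraticChar K w : ℂ) ^ Module.finrank K L *
        ((-1) ^ (Module.finrank K L - 1) * quadraticGaussSum ψ ^ Module.finrank K L) := by
  have : Invertible (2 : K) := invertibleOfNonzero (Ring.two_ne_zero hK)
  obtain ⟨n, hn, v, hv⟩ : ∃ n, Module.finrank K L = n ∧ ∃ v : Module.Basis (Fin n) K L,
      (Algebra.traceForm K L).IsOrthoᵢ v :=
    ⟨_, rfl, LinearMap.BilinForm.exists_orthogonal_basis
      ⟨fun x y => (Algebra.traceForm_isSymm K).eq x y⟩⟩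
  rw [hn]
  have hortho : ∀ i j, i ≠ j → Algebra.trace K L (v i * v j) = 0 := fun i j hij => by
    simpa [Function.onFun] using hv hij
  have hdiag : Algebra.traceMatrix K v =
      Matrix.diagonal fun i => Algebra.trace K L (v i ^ 2) := by
    ext i j
    rw [Algebra.traceMatrix_apply, Algebra.traceForm_apply, Matrix.diagonal_apply]
    split_ifs with h
    · rw [h, sq]
    · exact hortho i j h
  have hdisc : Algebra.discr K v = ∏ i, Algebra.trace K L (v i ^ 2) := by
    rw [Algebra.discr_def, hdiag, Matrix.det_diagonal]
  have hd0 : Algebra.discr K v ≠ 0 := Algebra.discr_not_zero_of_basis K v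
  have hη : quadraticChar K (Algebra.discr K v) = (-1) ^ (n - 1) := by
    have hpos : 0 < n := hn ▸ Module.finrank_pos
    rcases Nat.even_or_odd n with he | ho
    · rw [(Nat.Even.sub_odd hpos he odd_one).neg_one_pow, quadraticChar_neg_one_iff_not_isSquare,
        isSquare_discr_iff_odd hK v]
      exact Nat.not_odd_iff_even.2 he
    · rw [(Nat.Odd.sub_odd ho odd_one).neg_one_pow, quadraticChar_one_iff_isSquare hd0,
        isSquare_discr_iff_odd hK v]
      exact ho
  have hai : ∀ i, Algebra.trace K L (v i ^ 2) ≠ 0 := fun i => by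
    rw [hdisc] at hd0
    exact prod_ne_zero_iff.1 hd0 i (mem_univ i)
  have hsum : ∀ y : Fin n → K, Algebra.trace K L ((∑ i, y i • v i) ^ 2) =
      ∑ i, Algebra.trace K L (v i ^ 2) * y i ^ 2 := by
    intro y
    rw [sq, sum_mul_sum, map_sum]
    refine sum_congr rfl fun i _ => ?_
    rw [map_sum, sum_eq_single i]
    · rw [smul_mul_smul_comm, map_smul, smul_eq_mul, ← sq, ← sq, mul_comm]
    · intro j _ hj
      rw [smul_mul_smul_comm, map_smul, hortho i j hj.symm, smul_zero]
    · simp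
  rw [← v.equivFun.symm.toEquiv.sum_comp]
  simp only [LinearEquiv.coe_toEquiv, Module.Basis.equivFun_symm_apply, hsum]
  have hprod : ∀ y : Fin n → K, ψ (w * ∑ i, Algebra.trace K L (v i ^ 2) * y i ^ 2) =
      ∏ i, ψ (w * Algebra.trace K L (v i ^ 2) * y i ^ 2) := by
    intro y
    simp only [mul_sum, AddChar.map_sum_eq_prod, mul_assoc]
  simp only [hprod]
  rw [← Fintype.piFinset_univ,
    ← prod_univ_sum (fun _ => univ) fun i x => ψ (w * Algebra.trace K L (v i ^ 2) * x ^ 2)]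
  rw [prod_congr rfl fun i _ => sum_addChar_mul_sq hK hψ (mul_ne_zero hw (hai i))]
  rw [prod_mul_distrib, prod_const, card_univ, Fintype.card_fin, ← mul_assoc]
  congr 1
  simp only [map_mul, Int.cast_mul]
  rw [prod_mul_distrib, prod_const, card_univ, Fintype.card_fin]
  congr 1
  rw [← Int.cast_prod, ← map_prod, ← hdisc, hη]
  push_cast
  rfl

end GaussSums

/-! ### Points of the quadric Tr(x²) = t on affine subspaces. -/

section QuadricSections

theorem exists_isPrimitive_addChar_complex (K : Type*) [Field K] [Finite K] :
    ∃ ψ : AddChar K ℂ, ψ.IsPrimitive := by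
  obtain ⟨ψ, hψ⟩ := AddChar.exists_apply_ne_zero.2 (one_ne_zero (α := K))
  refine ⟨ψ, AddChar.IsPrimitive.of_ne_one fun h => hψ ?_⟩
  rw [h, AddChar.one_apply]

/-- Orthogonality of characters: if l u ≠ 0, the multiples of u already detect that ψ ∘ l is
nontrivial, because ψ is primitive. -/
theorem sum_addChar_linearMap {K : Type*} [Field K] {U : Type*} [AddCommGroup U] [Module K U]
    [Fintype U] {ψ : AddChar K ℂ} (hψ : ψ.IsPrimitive) (l : U →ₗ[K] K)
    [Decidable (l = 0)] :
    ∑ u, ψ (l u) = if l = 0 then (Fintype.card U : ℂ) else 0 := by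
  classical
  have h := AddChar.sum_eq_ite (ψ.compAddMonoidHom l.toAddMonoidHom)
  simp only [AddChar.compAddMonoidHom_apply, LinearMap.toAddMonoidHom_coe] at h
  rw [h]
  refine if_congr ⟨fun h0 => ?_, fun h0 => ?_⟩ rfl rfl
  · by_contra hl
    obtain ⟨u, hu⟩ := DFunLike.ne_iff.1 hl
    refine hψ hu (DFunLike.ext _ _ fun y => ?_)
    have := DFunLike.congr_fun h0 (y • u)
    simpa [AddChar.mulShift_apply, mul_comm] using this
  · subst h0
    ext u
    simp

variable {K : Type*} [Field K] [Fintype K] [DecidableEq K]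
variable {L : Type*} [Field L] [Fintype L] [Algebra K L]
variable {U : Type*} [AddCommGroup U] [Module K U] [Fintype U]

theorem sum_addChar_trace_mul {ψ : AddChar K ℂ} (hψ : ψ.IsPrimitive) (b : L) [Decidable (b = 0)] :
    ∑ x : L, ψ (Algebra.trace K L (b * x)) = if b = 0 then (Fintype.card L : ℂ) else 0 := by
  classical
  have h := sum_addChar_linearMap hψ (Algebra.traceForm K L b)
  simp only [Algebra.traceForm_apply] at h
  rw [h]
  refine if_congr ⟨fun h0 => ?_, fun h0 => by rw [h0, map_zero]⟩ rfl rfl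
  refine (traceForm_nondegenerate K L).1 b fun y => ?_
  rw [h0, LinearMap.zero_apply]

variable (l : U →ₗ[K] L) (c : U →ₗ[K] K) (t : K)

/-- The number of points of the quadric `Tr (x ^ 2) = t` on the affine subspace
`∀ u, Tr (l u * x) = c u`, as a sum of additive characters. -/
theorem card_quadric_section_eq_sum {ψ : AddChar K ℂ} (hψ : ψ.IsPrimitive) :
    (Fintype.card K * Fintype.card U *
      #{x : L | Algebra.trace K L (x ^ 2) = t ∧ ∀ u, Algebra.trace K L (l u * x) = c u} : ℂ) =
    ∑ w : K, ∑ u, ∑ x : L,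
      ψ (w * (Algebra.trace K L (x ^ 2) - t) + (Algebra.trace K L (l u * x) - c u)) := by
  classical
  rw [sum_congr rfl fun w _ => sum_comm, sum_comm, card_filter, Nat.cast_sum, mul_sum]
  refine sum_congr rfl fun x _ => ?_
  have h1 := AddChar.sum_mulShift (Algebra.trace K L (x ^ 2) - t) hψ
  have h2 := sum_addChar_linearMap hψ ((Algebra.traceForm K L x).comp l - c)
  simp only [LinearMap.sub_apply, LinearMap.comp_apply, Algebra.traceForm_apply] at h2
  have h3 : (Algebra.traceForm K L x).comp l - c = 0 ↔
      ∀ u, Algebra.trace K L (l u * x) = c u := by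
    rw [sub_eq_zero, LinearMap.ext_iff]
    simp only [LinearMap.comp_apply, Algebra.traceForm_apply, mul_comm x]
  simp only [mul_comm _ x] at h3 ⊢
  simp only [AddChar.map_add_eq_mul, ← mul_sum, ← sum_mul]
  rw [h1, h2]
  simp only [h3, sub_eq_zero]
  by_cases ha : Algebra.trace K L (x ^ 2) = t <;>
    by_cases hb : ∀ u, Algebra.trace K L (x * l u) = c u <;> simp [ha, hb]

variable {l}

/-- Among the terms with w = 0 only u = 0 survives, by injectivity of l, and contributes the order
of L. For w ≠ 0, completing the square in x separates the exponential sum of the trace form from a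
phase depending on u and w. -/
theorem card_quadric_section (hK : ringChar K ≠ 2) {ψ : AddChar K ℂ} (hψ : ψ.IsPrimitive)
    (hl : Function.Injective l) :
    (Fintype.card K * Fintype.card U *
      #{x : L | Algebra.trace K L (x ^ 2) = t ∧ ∀ u, Algebra.trace K L (l u * x) = c u} : ℂ) =
    Fintype.card L + (-1) ^ (Module.finrank K L - 1) * quadraticGaussSum ψ ^ Module.finrank K L *
      ∑ u, ∑ w : K with w ≠ 0, (quadraticChar K w : ℂ) ^ Module.finrank K L *
        ψ (w * -(Algebra.trace K L (l u ^ 2) + 2 * c u + t)) := by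
  classical
  rw [card_quadric_section_eq_sum l c t hψ, ← add_sum_erase _ _ (mem_univ 0)]
  congr 1
  · have h : ∀ u, ∑ x : L, ψ (0 * (Algebra.trace K L (x ^ 2) - t) +
        (Algebra.trace K L (l u * x) - c u)) =
        if u = 0 then (Fintype.card L : ℂ) else 0 := by
      intro u
      simp only [zero_mul, zero_add, sub_eq_add_neg, AddChar.map_add_eq_mul, ← sum_mul]
      rw [sum_addChar_trace_mul hψ]
      simp only [map_eq_zero_iff l hl]
      split_ifs with h
      · rw [h, map_zero, neg_zero, AddChar.map_zero_eq_one, mul_one]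
      · rw [zero_mul]
    rw [sum_congr rfl fun u _ => h u, sum_ite_eq' univ (0 : U), if_pos (mem_univ _)]
  · have he : (univ.erase 0 : Finset K) = ({w | w ≠ 0} : Finset K) := by ext; simp
    rw [he, sum_comm (s := (univ : Finset U)), mul_sum]
    refine sum_congr rfl fun w hw => ?_
    have hw0 : w ≠ 0 := (mem_filter.1 hw).2
    have h2w : 2 * w ≠ 0 := mul_ne_zero (Ring.two_ne_zero hK) hw0
    -- Replacing u by 2wu makes the cross term equal to 2w Tr(l(u)x), so that x + l(u) completes the
    -- square.
    rw [← (LinearEquiv.smulOfNeZero K U (2 * w) h2w).toEquiv.sum_comp, mul_sum]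
    refine sum_congr rfl fun u _ => ?_
    have hx : ∀ x : L, w * (Algebra.trace K L (x ^ 2) - t) +
        (Algebra.trace K L (l ((2 * w) • u) * x) - c ((2 * w) • u)) =
        w * Algebra.trace K L ((x + l u) ^ 2) +
          w * -(Algebra.trace K L (l u ^ 2) + 2 * c u + t) := by
      intro x
      have : (x + l u) ^ 2 = x ^ 2 + l u ^ 2 + (2 : K) • (l u * x) := by
        rw [Algebra.smul_def, map_ofNat]; ring
      rw [this, map_smul, map_smul, map_add, map_add, map_smul, smul_mul_assoc, map_smul]
      simp only [smul_eq_mul]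
      ring
    simp only [LinearEquiv.coe_toEquiv, LinearEquiv.smulOfNeZero_apply, hx,
      AddChar.map_add_eq_mul, ← sum_mul]
    rw [Fintype.sum_equiv (Equiv.addRight (l u)) (fun x => ψ (w * Algebra.trace K L ((x + l u) ^ 2)))
        (fun x => ψ (w * Algebra.trace K L (x ^ 2))) fun _ => rfl,
      sum_addChar_mul_trace_sq hK hψ hw0]
    ring

theorem quadraticGaussSum_pow_of_even (hK : ringChar K ≠ 2) {ψ : AddChar K ℂ}
    (hψ : ψ.IsPrimitive) {k : ℕ} (hk : Even k) :
    quadraticGaussSum ψ ^ k =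
      ((quadraticChar K (-1) ^ (k / 2) * (Fintype.card K : ℤ) ^ (k / 2) : ℤ) : ℂ) := by
  obtain ⟨j, rfl⟩ := hk.two_dvd
  rw [pow_mul, quadraticGaussSum_sq hK hψ, mul_pow]
  simp

/-- For even m the factor η(w)^m is 1 on nonzero w, so the sum over w detects the zeros of the
polynomial in u. -/
theorem card_quadric_section_of_even (hK : ringChar K ≠ 2) (hl : Function.Injective l)
    (hm : Even (Module.finrank K L)) :
    (Fintype.card K * Fintype.card U *
      #{x : L | Algebra.trace K L (x ^ 2) = t ∧ ∀ u, Algebra.trace K L (l u * x) = c u} : ℤ) =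
    Fintype.card L - quadraticChar K (-1) ^ (Module.finrank K L / 2) *
      (Fintype.card K : ℤ) ^ (Module.finrank K L / 2) *
      (Fintype.card K * #{u | Algebra.trace K L (l u ^ 2) + 2 * c u + t = 0} -
        Fintype.card U) := by
  obtain ⟨ψ, hψ⟩ := exists_isPrimitive_addChar_complex K
  have h := card_quadric_section c t hK hψ hl
  rw [quadraticGaussSum_pow_of_even hK hψ hm,
    (Nat.Even.sub_odd Module.finrank_pos hm odd_one).neg_one_pow] at h
  have hu : ∀ u, ∑ w : K with w ≠ 0, (quadraticChar K w : ℂ) ^ Module.finrank K L *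
      ψ
        (w * -(Algebra.trace K L (l u ^ 2) + 2 * c u + t)) =
      (if Algebra.trace K L (l u ^ 2) + 2 * c u + t = 0 then (Fintype.card K : ℂ) else 0) - 1 := by
    intro u
    rw [sum_congr rfl (g := fun w => ψ
        (w * -(Algebra.trace K L (l u ^ 2) + 2 * c u + t))), sum_ne_zero_addChar_mul hψ]
    · simp only [neg_eq_zero]
    · intro w hw
      have h1 : ((quadraticChar K w : ℤ) : ℂ) ^ 2 = 1 := by
        exact_mod_cast quadraticChar_sq_one (mem_filter.1 hw).2
      obtain ⟨j, hj⟩ := hm.two_dvd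
      rw [hj, pow_mul, h1, one_pow, one_mul]
  simp only [hu, sum_sub_distrib, ← sum_filter, sum_const, card_univ, nsmul_eq_mul, mul_one] at h
  have : (((Fintype.card K * Fintype.card U *
      #{x : L | Algebra.trace K L (x ^ 2) = t ∧ ∀ u, Algebra.trace K L (l u * x) = c u} : ℤ)) : ℂ) =
    ((Fintype.card L - quadraticChar K (-1) ^ (Module.finrank K L / 2) *
      (Fintype.card K : ℤ) ^ (Module.finrank K L / 2) *
      (Fintype.card K * #{u | Algebra.trace K L (l u ^ 2) + 2 * c u + t = 0} -
        Fintype.card U) : ℤ) : ℂ) := by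
    push_cast at h ⊢
    rw [h]
    ring
  exact_mod_cast this

/-- For odd m the factor η(w)^m is η(w), so the sum over w is a further Gauss sum: it leaves η of
the polynomial in u and raises G^m to the even power G^(m+1). -/
theorem card_quadric_section_of_odd (hK : ringChar K ≠ 2) (hl : Function.Injective l)
    (hm : Odd (Module.finrank K L)) :
    (Fintype.card K * Fintype.card U *
      #{x : L | Algebra.trace K L (x ^ 2) = t ∧ ∀ u, Algebra.trace K L (l u * x) = c u} : ℤ) =
    Fintype.card L + quadraticChar K (-1) ^ ((Module.finrank K L + 1) / 2) *
      (Fintype.card K : ℤ) ^ ((Module.finrank K L + 1) / 2) *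
      ∑ u, quadraticChar K (-(Algebra.trace K L (l u ^ 2) + 2 * c u + t)) := by
  obtain ⟨ψ, hψ⟩ := exists_isPrimitive_addChar_complex K
  have h := card_quadric_section c t hK hψ hl
  have hG := quadraticGaussSum_pow_of_even hK hψ hm.add_one
  rw [(Nat.Odd.sub_odd hm odd_one).neg_one_pow] at h
  have hu : ∀ u, ∑ w : K with w ≠ 0, (quadraticChar K w : ℂ) ^ Module.finrank K L *
      ψ
        (w * -(Algebra.trace K L (l u ^ 2) + 2 * c u + t)) =
      (quadraticChar K (-(Algebra.trace K L (l u ^ 2) + 2 * c u + t)) : ℂ) *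
        quadraticGaussSum ψ := by
    intro u
    -- The term w = 0 may be included because η(0) = 0.
    rw [← sum_quadraticChar_mul_addChar hK, sum_filter]
    refine sum_congr rfl fun w _ => ?_
    split_ifs with hw
    · have h1 : ((quadraticChar K w : ℤ) : ℂ) ^ 2 = 1 := by
        exact_mod_cast quadraticChar_sq_one hw
      obtain ⟨j, hj⟩ := hm
      rw [hj, pow_succ, pow_mul, h1, one_pow, one_mul]
    · rw [not_not.1 hw]
      simp
  simp only [hu, ← sum_mul] at h
  rw [one_mul, mul_comm (∑ u, _), ← mul_assoc, ← pow_succ, hG] at h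
  exact_mod_cast h

end QuadricSections

/-! ### The trace form on the line spanned by 1 and the plane spanned by 1 and a. -/

section Plane

variable {K L : Type*} [Field K] [Field L] [Algebra K L]

theorem injective_toSpanSingleton_one :
    Function.Injective (LinearMap.toSpanSingleton K L 1) :=
  fun _ _ h => smul_left_injective K one_ne_zero h

/-- The parametrization of the plane spanned by `1` and `a`. -/
noncomputable def planeMap (K : Type*) [Field K] [Algebra K L] (a : L) : K × K →ₗ[K] L :=
  (LinearMap.toSpanSingleton K L 1).coprod (LinearMap.toSpanSingleton K L a)

theorem planeMap_apply (a : L) (u : K × K) : planeMap K a u = u.1 • 1 + u.2 • a := rfl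

theorem injective_planeMap {a : L} (ha : a ∉ Set.range (algebraMap K L)) :
    Function.Injective (planeMap K a) := by
  rw [← LinearMap.ker_eq_bot, LinearMap.ker_eq_bot']
  rintro ⟨u, v⟩ h
  rw [planeMap_apply] at h
  dsimp only at h
  have hv : v = 0 := by
    by_contra hv
    refine ha ⟨-u / v, ?_⟩
    rw [Algebra.algebraMap_eq_smul_one, div_eq_inv_mul, ← smul_smul, neg_smul,
      ← eq_neg_of_add_eq_zero_right h, smul_smul, inv_mul_cancel₀ hv, one_smul]
  subst hv
  rw [zero_smul, add_zero, smul_eq_zero] at h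
  rw [h.resolve_right one_ne_zero]
  rfl

theorem trace_one_eq_finrank : Algebra.trace K L 1 = (Module.finrank K L : K) := by
  have h := Algebra.trace_algebraMap (S := L) (1 : K)
  rw [map_one] at h
  rw [h, nsmul_eq_mul, mul_one]

theorem trace_smul_one_sq (u : K) :
    Algebra.trace K L ((u • (1 : L)) ^ 2) = Module.finrank K L * u ^ 2 := by
  rw [smul_pow, one_pow, map_smul, trace_one_eq_finrank, smul_eq_mul, mul_comm]

theorem trace_planeMap_sq (a : L) (u : K × K) :
    Algebra.trace K L (planeMap K a u ^ 2) = Module.finrank K L * u.1 ^ 2 +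
      2 * Algebra.trace K L a * u.1 * u.2 + Algebra.trace K L (a ^ 2) * u.2 ^ 2 := by
  have h : planeMap K a u ^ 2 = (u.1 ^ 2) • (1 : L) + (2 * u.1 * u.2) • a + (u.2 ^ 2) • a ^ 2 := by
    simp only [planeMap_apply, Algebra.smul_def, map_mul, map_pow, map_ofNat]
    ring
  rw [h, map_add, map_add, map_smul, map_smul, map_smul, trace_one_eq_finrank]
  simp only [smul_eq_mul]
  ring

end Plane

/-! ### The fibre sizes of (Tr a, Tr(a²)) and the numbers N_ρ as root counts or character sums. -/

section Counts

variable (K : Type*) [Field K] [Fintype K] [DecidableEq K]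
variable {L : Type*} [Field L] [Fintype L] [Algebra K L]

variable (L) in
/-- The number of `a` with `Tr a = s` and `Tr (a ^ 2) = t`. -/
noncomputable def tracePairCount (s t : K) : ℕ :=
  #{a : L | Algebra.trace K L a = s ∧ Algebra.trace K L (a ^ 2) = t}

variable {K}

/-- The number of `x` with `Tr x = 1`, `Tr (x ^ 2) = 0` and `Tr (a * x) = ρ`. -/
noncomputable def sectionCount (a : L) (ρ : K) : ℕ :=
  #{x : L | (Algebra.trace K L x = 1 ∧ Algebra.trace K L (x ^ 2) = 0) ∧
    Algebra.trace K L (a * x) = ρ}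

theorem tracePairCount_eq_card (s t : K) :
    tracePairCount K L s t = #{x : L | Algebra.trace K L (x ^ 2) = t ∧
      ∀ u, Algebra.trace K L (LinearMap.toSpanSingleton K L 1 u * x) =
        LinearMap.toSpanSingleton K K s u} := by
  rw [tracePairCount]
  congr 1
  refine filter_congr fun x _ => ?_
  rw [and_comm]
  refine and_congr_right fun _ => ⟨fun h u => ?_, fun h => ?_⟩
  · simp [h]
  · simpa using h 1

theorem sectionCount_eq_card (a : L) (ρ : K) :
    sectionCount a ρ = #{x : L | Algebra.trace K L (x ^ 2) = 0 ∧
      ∀ u, Algebra.trace K L (planeMap K a u * x) =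
        (LinearMap.fst K K K + ρ • LinearMap.snd K K K) u} := by
  rw [sectionCount]
  congr 1
  refine filter_congr fun x _ => ?_
  have h : ∀ u : K × K, Algebra.trace K L (planeMap K a u * x) =
      u.1 * Algebra.trace K L x + u.2 * Algebra.trace K L (a * x) := by
    intro u
    rw [planeMap_apply, add_mul, smul_mul_assoc, smul_mul_assoc, one_mul, map_add, map_smul,
      map_smul, smul_eq_mul, smul_eq_mul]
  simp only [h, LinearMap.add_apply, LinearMap.smul_apply, LinearMap.fst_apply,
    LinearMap.snd_apply, smul_eq_mul]
  constructor
  · rintro ⟨⟨h1, h2⟩, h3⟩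
    exact ⟨h2, fun u => by rw [h1, h3]; ring⟩
  · rintro ⟨h2, h3⟩
    have h10 := h3 (1, 0)
    have h01 := h3 (0, 1)
    simp only [one_mul, zero_mul, add_zero, zero_add, mul_zero, mul_one] at h10 h01
    exact ⟨⟨h10, h2⟩, h01⟩

/-- The polynomial attached to `planeMap` and the values `1`, `ρ` of the two linear forms. -/
def planePoly (μ s t ρ : K) (u v : K) : K :=
  μ * u ^ 2 + 2 * s * u * v + t * v ^ 2 + 2 * (u + ρ * v)

variable (hK : ringChar K ≠ 2) {j : ℕ} {ε : ℤ}
include hK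

section Even

variable (hm : Module.finrank K L = 2 * j + 4) (hε : ε = quadraticChar K (-1) ^ (j + 2))
include hm hε

theorem tracePairCount_even (s t : K) :
    (tracePairCount K L s t : ℤ) = (Fintype.card K : ℤ) ^ (2 * j + 2) -
      ε * (Fintype.card K : ℤ) ^ (j + 1) *
        (#{u : K | Module.finrank K L * u ^ 2 + 2 * s * u + t = 0} - 1) := by
  have h := card_quadric_section_of_even (L := L) (U := K) (LinearMap.toSpanSingleton K K s) t hK
    injective_toSpanSingleton_one (hm ▸ ⟨j + 2, by ring⟩)
  rw [← tracePairCount_eq_card, Module.card_eq_pow_finrank (K := K) (V := L)] at h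
  have hq : (Fintype.card K : ℤ) ≠ 0 := by exact_mod_cast Fintype.card_ne_zero
  have hj : (2 * j + 4) / 2 = j + 2 := by omega
  have hset : #{u : K | Algebra.trace K L (LinearMap.toSpanSingleton K L 1 u ^ 2) +
      2 * LinearMap.toSpanSingleton K K s u + t = 0} =
      #{u : K | Module.finrank K L * u ^ 2 + 2 * s * u + t = 0} := by
    congr 1
    refine filter_congr fun u _ => ?_
    rw [LinearMap.toSpanSingleton_apply, LinearMap.toSpanSingleton_apply, trace_smul_one_sq,
      smul_eq_mul, mul_comm u s, mul_assoc 2 s u]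
  rw [hset] at h
  generalize #{u : K | Module.finrank K L * u ^ 2 + 2 * s * u + t = 0} = z at h ⊢
  rw [hm, hj, ← hε] at h
  refine mul_left_cancel₀ (mul_ne_zero hq hq) ?_
  rw [h]
  push_cast
  ring

theorem sectionCount_even {a : L} (ha : a ∉ Set.range (algebraMap K L)) (ρ : K) :
    (sectionCount a ρ : ℤ) = (Fintype.card K : ℤ) ^ (2 * j + 1) -
      ε * (Fintype.card K : ℤ) ^ j *
        (#{u : K × K | planePoly (Module.finrank K L : K) (Algebra.trace K L a)
          (Algebra.trace K L (a ^ 2)) ρ u.1 u.2 = 0} - Fintype.card K) := by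
  have h := card_quadric_section_of_even (L := L) (U := K × K)
    (LinearMap.fst K K K + ρ • LinearMap.snd K K K) 0 hK (injective_planeMap ha)
    (hm ▸ ⟨j + 2, by ring⟩)
  rw [← sectionCount_eq_card, Module.card_eq_pow_finrank (K := K) (V := L)] at h
  have hq : (Fintype.card K : ℤ) ≠ 0 := by exact_mod_cast Fintype.card_ne_zero
  have hj : (2 * j + 4) / 2 = j + 2 := by omega
  have hset : #{u : K × K | Algebra.trace K L (planeMap K a u ^ 2) +
      2 * (LinearMap.fst K K K + ρ • LinearMap.snd K K K) u + 0 = 0} =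
      #{u : K × K | planePoly (Module.finrank K L : K) (Algebra.trace K L a)
          (Algebra.trace K L (a ^ 2)) ρ u.1 u.2 = 0} := by
    congr 1
    refine filter_congr fun u _ => ?_
    rw [trace_planeMap_sq, add_zero]
    rfl
  rw [hset] at h
  generalize #{u : K × K | planePoly (Module.finrank K L : K) (Algebra.trace K L a)
          (Algebra.trace K L (a ^ 2)) ρ u.1 u.2 = 0} = z at h ⊢
  rw [hm, hj, ← hε, Fintype.card_prod] at h
  refine mul_left_cancel₀ (mul_ne_zero hq (mul_ne_zero hq hq)) ?_
  push_cast at h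
  rw [← mul_assoc, mul_assoc (Fintype.card K : ℤ), h]
  ring

end Even

section Odd

variable (hm : Module.finrank K L = 2 * j + 3) (hε : ε = quadraticChar K (-1) ^ (j + 2))
include hm hε

theorem tracePairCount_odd (s t : K) :
    (tracePairCount K L s t : ℤ) = (Fintype.card K : ℤ) ^ (2 * j + 1) +
      ε * (Fintype.card K : ℤ) ^ j *
        ∑ u : K, quadraticChar K (-Module.finrank K L * u ^ 2 + -2 * s * u + -t) := by
  have h := card_quadric_section_of_odd (L := L) (U := K) (LinearMap.toSpanSingleton K K s) t hK
    injective_toSpanSingleton_one (hm ▸ ⟨j + 1, by ring⟩)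
  rw [← tracePairCount_eq_card, Module.card_eq_pow_finrank (K := K) (V := L)] at h
  have hq : (Fintype.card K : ℤ) ≠ 0 := by exact_mod_cast Fintype.card_ne_zero
  have hj : (2 * j + 3 + 1) / 2 = j + 2 := by omega
  have hsum : ∑ u : K, quadraticChar K (-(Algebra.trace K L
      (LinearMap.toSpanSingleton K L 1 u ^ 2) + 2 * LinearMap.toSpanSingleton K K s u + t)) =
      ∑ u : K, quadraticChar K (-Module.finrank K L * u ^ 2 + -2 * s * u + -t) := by
    refine sum_congr rfl fun u _ => ?_
    rw [LinearMap.toSpanSingleton_apply, LinearMap.toSpanSingleton_apply, trace_smul_one_sq,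
      smul_eq_mul]
    congr 1
    ring
  rw [hsum] at h
  generalize ∑ u : K, quadraticChar K (-Module.finrank K L * u ^ 2 + -2 * s * u + -t) = z at h ⊢
  rw [hm, hj, ← hε] at h
  refine mul_left_cancel₀ (mul_ne_zero hq hq) ?_
  rw [h]
  push_cast
  ring

/-- One factor q stays on the left: that it divides the double sum is seen only once that sum is
evaluated. -/
theorem sectionCount_odd {a : L} (ha : a ∉ Set.range (algebraMap K L)) (ρ : K) :
    (Fintype.card K * sectionCount a ρ : ℤ) = (Fintype.card K : ℤ) ^ (2 * j + 1) +
      ε * (Fintype.card K : ℤ) ^ j *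
        ∑ v : K, ∑ u : K, quadraticChar K (-planePoly (Module.finrank K L : K)
          (Algebra.trace K L a) (Algebra.trace K L (a ^ 2)) ρ u v) := by
  have h := card_quadric_section_of_odd (L := L) (U := K × K)
    (LinearMap.fst K K K + ρ • LinearMap.snd K K K) 0 hK (injective_planeMap ha)
    (hm ▸ ⟨j + 1, by ring⟩)
  rw [← sectionCount_eq_card, Module.card_eq_pow_finrank (K := K) (V := L)] at h
  have hq : (Fintype.card K : ℤ) ≠ 0 := by exact_mod_cast Fintype.card_ne_zero
  have hj : (2 * j + 3 + 1) / 2 = j + 2 := by omega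
  have hsum : ∑ u : K × K, quadraticChar K (-(Algebra.trace K L (planeMap K a u ^ 2) +
      2 * (LinearMap.fst K K K + ρ • LinearMap.snd K K K) u + 0)) =
      ∑ v : K, ∑ u : K, quadraticChar K (-planePoly (Module.finrank K L : K)
          (Algebra.trace K L a) (Algebra.trace K L (a ^ 2)) ρ u v) := by
    rw [sum_comm, ← Fintype.sum_prod_type']
    refine sum_congr rfl fun u _ => ?_
    rw [trace_planeMap_sq, add_zero]
    rfl
  rw [hsum] at h
  generalize ∑ v : K, ∑ u : K, quadraticChar K (-planePoly (Module.finrank K L : K)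
          (Algebra.trace K L a) (Algebra.trace K L (a ^ 2)) ρ u v) = z at h ⊢
  rw [hm, hj, ← hε, Fintype.card_prod] at h
  refine mul_left_cancel₀ (mul_ne_zero hq hq) ?_
  push_cast at h
  linear_combination h

end Odd

end Counts

/-! ### Evaluation of the sums attached to the plane. -/

section PlanePoly

section

variable {K : Type*} [Field K]

theorem planePoly_zero_left (s t ρ u v : K) :
    planePoly 0 s t ρ u v = 2 * (s * v + 1) * u + (t * v ^ 2 + 2 * ρ * v) := by
  rw [planePoly]; ring

theorem planePoly_eq (μ s t ρ u v : K) :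
    planePoly μ s t ρ u v = μ * u ^ 2 + 2 * (s * v + 1) * u + (t * v ^ 2 + 2 * ρ * v) := by
  rw [planePoly]; ring

/-- A quarter of the discriminant of `planePoly` with respect to its first variable. -/
def planeDisc (μ s t ρ v : K) : K :=
  (s ^ 2 - μ * t) * v ^ 2 + 2 * (s - μ * ρ) * v + 1

theorem four_ne_zero_of_ringChar_ne_two (hK : ringChar K ≠ 2) : (4 : K) ≠ 0 := by
  have h4 : (4 : K) = 2 ^ 2 := by norm_num
  rw [h4]
  exact pow_ne_zero _ (Ring.two_ne_zero hK)

end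

variable {K : Type*} [Field K] [Fintype K] [DecidableEq K]

theorem card_linear_roots {A : K} (hA : A ≠ 0) (B : K) : #{u : K | A * u + B = 0} = 1 := by
  rw [card_eq_one]
  refine ⟨-B / A, ?_⟩
  ext u
  simp only [mem_filter, mem_univ, true_and, mem_singleton]
  rw [eq_div_iff hA]
  constructor <;> intro h <;> linear_combination h

theorem sum_quadraticChar_linear (hK : ringChar K ≠ 2) {A : K} (hA : A ≠ 0) (B : K) :
    ∑ u : K, quadraticChar K (A * u + B) = 0 := by
  have hb : Function.Bijective fun u : K => A * u + B :=
    Finite.injective_iff_bijective.1 fun x y h => mul_left_cancel₀ hA (add_right_cancel h)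
  rw [hb.sum_comp fun y => quadraticChar K y]
  exact quadraticChar_sum_zero hK

theorem card_planePoly_roots (μ s t ρ : K) :
    #{u : K × K | planePoly μ s t ρ u.1 u.2 = 0} =
      ∑ v : K, #{u : K | planePoly μ s t ρ u v = 0} := by
  rw [card_filter, Fintype.sum_prod_type_right]
  simp only [card_filter]

theorem quadraticChar_four_mul (hK : ringChar K ≠ 2) (x : K) :
    quadraticChar K (4 * x) = quadraticChar K x := by
  have h4 : (4 : K) = 2 ^ 2 := by norm_num
  rw [h4, map_mul, quadraticChar_sq_one' (Ring.two_ne_zero hK), one_mul]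

variable (hK : ringChar K ≠ 2)
include hK

theorem card_planePoly_zero_zero_roots (t ρ : K) :
    #{u : K × K | planePoly 0 0 t ρ u.1 u.2 = 0} = Fintype.card K := by
  rw [card_planePoly_roots, ← card_univ, card_eq_sum_ones]
  refine sum_congr rfl fun v _ => ?_
  simp only [planePoly_zero_left]
  exact card_linear_roots (by simpa using Ring.two_ne_zero hK) _

/-- The polynomial is linear in u with leading coefficient 2(sv + 1). Each v ≠ -1/s gives one root;
at v = -1/s it is constant in u and vanishes iff t = 2ρs. -/
theorem card_planePoly_zero_roots {s : K} (hs : s ≠ 0) (t ρ : K) :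
    (#{u : K × K | planePoly 0 s t ρ u.1 u.2 = 0} : ℤ) =
      (if t = 2 * ρ * s then (Fintype.card K : ℤ) else 0) + (Fintype.card K - 1) := by
  have h2 := Ring.two_ne_zero hK
  have h1 : 1 ≤ Fintype.card K := Fintype.card_pos
  rw [card_planePoly_roots, ← add_sum_erase _ _ (mem_univ (-1 / s))]
  push_cast
  congr 1
  · simp only [planePoly_zero_left, mul_div_cancel₀ _ hs]
    have h : ∀ u : K, 2 * (-1 + 1) * u + (t * (-1 / s) ^ 2 + 2 * ρ * (-1 / s)) = 0 ↔
        t = 2 * ρ * s := by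
      intro u
      field_simp
      constructor <;> intro h <;> linear_combination h
    simp only [h]
    by_cases ht : t = 2 * ρ * s <;> simp [ht]
  · rw [sum_congr rfl (g := fun _ => (1 : ℤ))]
    · rw [sum_const, card_erase_of_mem (mem_univ _), card_univ, nsmul_eq_mul, mul_one]
      push_cast [h1]
      rfl
    · intro v hv
      simp only [planePoly_zero_left]
      rw [card_linear_roots, Nat.cast_one]
      refine mul_ne_zero h2 fun h => (mem_erase.1 hv).1 ?_
      rw [eq_div_iff hs]
      linear_combination h

theorem sum_quadraticChar_planePoly_zero_zero (t ρ : K) :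
    ∑ v : K, ∑ u : K, quadraticChar K (-planePoly 0 0 t ρ u v) = 0 := by
  refine sum_eq_zero fun v _ => ?_
  rw [← sum_quadraticChar_linear hK (A := -2) (neg_ne_zero.2 (Ring.two_ne_zero hK))
    (-(t * v ^ 2 + 2 * ρ * v))]
  refine sum_congr rfl fun u _ => congrArg _ ?_
  rw [planePoly_zero_left]
  ring

/-- Only v = -1/s contributes: for every other v the argument of η is a nonconstant linear function
of u, and η sums to zero. -/
theorem sum_quadraticChar_planePoly_zero {s : K} (hs : s ≠ 0) (t ρ : K) :
    ∑ v : K, ∑ u : K, quadraticChar K (-planePoly 0 s t ρ u v) =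
      Fintype.card K * quadraticChar K (2 * ρ * s - t) := by
  have h2 := Ring.two_ne_zero hK
  rw [← add_sum_erase _ _ (mem_univ (-1 / s)), sum_eq_zero (s := univ.erase (-1 / s)), add_zero]
  · rw [sum_congr rfl (g := fun _ => quadraticChar K (2 * ρ * s - t)), sum_const, card_univ,
      nsmul_eq_mul]
    intro u _
    have h : 2 * ρ * s - t = s ^ 2 * -planePoly 0 s t ρ u (-1 / s) := by
      rw [planePoly_zero_left]
      field_simp
      ring
    rw [h, map_mul, quadraticChar_sq_one' hs, one_mul]
  · intro v hv
    have hA : -(2 * (s * v + 1)) ≠ 0 := by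
      refine neg_ne_zero.2 (mul_ne_zero h2 fun h => (mem_erase.1 hv).1 ?_)
      rw [eq_div_iff hs]
      linear_combination h
    rw [← sum_quadraticChar_linear hK hA (-(t * v ^ 2 + 2 * ρ * v))]
    refine sum_congr rfl fun u _ => congrArg _ ?_
    rw [planePoly_zero_left]
    ring

variable {μ : K}

theorem sum_quadraticChar_planeDisc_of_disc_eq_zero {s t : K} (hD : s ^ 2 - μ * t = 0) (ρ : K) :
    ∑ v : K, quadraticChar K (planeDisc μ s t ρ v) =
      if μ * ρ = s then (Fintype.card K : ℤ) else 0 := by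
  have h2 := Ring.two_ne_zero hK
  simp only [planeDisc, hD, zero_mul, zero_add]
  split_ifs with h
  · simp [h]
  · exact sum_quadraticChar_linear hK (mul_ne_zero h2 (sub_ne_zero.2 (Ne.symm h))) 1

/-- As a quadratic in v, `planeDisc` has discriminant 4((μρ - s)² - (s² - μt)); hence the polynomial
in ρ that governs the patterns. -/
theorem sum_quadraticChar_planeDisc {s t : K} (hD : s ^ 2 - μ * t ≠ 0) (ρ : K) :
    ∑ v : K, quadraticChar K (planeDisc μ s t ρ v) = quadraticChar K (s ^ 2 - μ * t) *
      if (μ * ρ - s) ^ 2 = s ^ 2 - μ * t then (Fintype.card K : ℤ) - 1 else -1 := by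
  have h4 := four_ne_zero_of_ringChar_ne_two hK
  simp only [planeDisc]
  rw [sum_quadraticChar_quadratic hK hD]
  congr 1
  refine if_congr ?_ rfl rfl
  rw [← sub_eq_zero (b := s ^ 2 - μ * t)]
  have : (2 * (s - μ * ρ)) ^ 2 - 4 * (s ^ 2 - μ * t) * 1 =
    4 * ((μ * ρ - s) ^ 2 - (s ^ 2 - μ * t)) := by ring
  rw [this, mul_eq_zero]
  simp only [h4, false_or]

theorem card_planeDisc_roots_of_disc_eq_zero {s t : K} (hD : s ^ 2 - μ * t = 0) (ρ : K) :
    (#{v : K | planeDisc μ s t ρ v = 0} : ℤ) - 1 = -if μ * ρ = s then 1 else 0 := by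
  have h2 := Ring.two_ne_zero hK
  simp only [planeDisc, hD, zero_mul, zero_add]
  split_ifs with h
  · simp [h]
  · rw [card_linear_roots (mul_ne_zero h2 (sub_ne_zero.2 (Ne.symm h))) 1]
    simp

theorem card_planeDisc_roots {s t : K} (hD : s ^ 2 - μ * t ≠ 0) (ρ : K) :
    (#{v : K | planeDisc μ s t ρ v = 0} : ℤ) - 1 =
      quadraticChar K ((μ * ρ - s) ^ 2 - (s ^ 2 - μ * t)) := by
  have h : (#{v : K | planeDisc μ s t ρ v = 0} : ℤ) = _ := card_quadratic_roots hK hD _ _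
  rw [h, add_sub_cancel_right, ← quadraticChar_four_mul hK ((_ - _) ^ 2 - _)]
  congr 1
  ring

variable (hμ : μ ≠ 0)
include hμ

/-- For fixed v there are 1 + η(discriminant) roots u. Thus even m leads to a character sum of
`planeDisc`, whereas odd m leads to its number of roots in `sum_quadraticChar_planePoly`. -/
theorem card_planePoly_roots_sub_card (s t ρ : K) :
    (#{u : K × K | planePoly μ s t ρ u.1 u.2 = 0} : ℤ) - Fintype.card K =
      ∑ v : K, quadraticChar K (planeDisc μ s t ρ v) := by
  rw [card_planePoly_roots, Nat.cast_sum, sum_congr rfl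
    (g := fun v => quadraticChar K (planeDisc μ s t ρ v) + 1)]
  · rw [sum_add_distrib, sum_const, card_univ, nsmul_eq_mul, mul_one, add_sub_cancel_right]
  · intro v _
    simp only [planePoly_eq]
    rw [card_quadratic_roots hK hμ, ← quadraticChar_four_mul hK (planeDisc _ _ _ _ _)]
    congr 2
    rw [planeDisc]
    ring

theorem sum_quadraticChar_planePoly (s t ρ : K) :
    ∑ v : K, ∑ u : K, quadraticChar K (-planePoly μ s t ρ u v) =
      Fintype.card K * (quadraticChar K (-μ) * (#{v : K | planeDisc μ s t ρ v = 0} - 1)) := by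
  have h4 := four_ne_zero_of_ringChar_ne_two hK
  have h : ∀ v : K, ∑ u : K, quadraticChar K (-planePoly μ s t ρ u v) =
      quadraticChar K (-μ) *
        ((if planeDisc μ s t ρ v = 0 then (Fintype.card K : ℤ) else 0) - 1) := by
    intro v
    have h0 := sum_quadraticChar_quadratic hK (neg_ne_zero.2 hμ) (-(2 * (s * v + 1)))
      (-(t * v ^ 2 + 2 * ρ * v))
    have hD : (-(2 * (s * v + 1))) ^ 2 - 4 * -μ * -(t * v ^ 2 + 2 * ρ * v) =
        4 * planeDisc μ s t ρ v := by
      rw [planeDisc]; ring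
    rw [hD] at h0
    simp only [mul_eq_zero, h4, false_or] at h0
    rw [sum_congr rfl fun u _ => congrArg _ ?_, h0]
    · split_ifs <;> ring
    · rw [planePoly_eq]
      ring
  simp only [h]
  rw [← mul_sum, sum_sub_distrib, ← sum_filter, sum_const, sum_const, card_univ]
  simp only [nsmul_eq_mul]
  ring

end PlanePoly

/-! ### Closed forms of the fibre sizes and of N_ρ, by parity of m and vanishing of μ. -/

section Counts

variable {K : Type*} [Field K] [Fintype K] [DecidableEq K]
variable {L : Type*} [Field L] [Fintype L] [Algebra K L]
variable (hK : ringChar K ≠ 2) {j : ℕ} {ε : ℤ}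
include hK

section Even

variable (hm : Module.finrank K L = 2 * j + 4) (hε : ε = quadraticChar K (-1) ^ (j + 2))
include hm hε

theorem tracePairCount_even_of_eq_zero (hμ : (Module.finrank K L : K) = 0) {s : K} (hs : s ≠ 0)
    (t : K) : (tracePairCount K L s t : ℤ) = (Fintype.card K : ℤ) ^ (2 * j + 2) := by
  have h := tracePairCount_even hK hm hε s t
  simp only [hμ, zero_mul, zero_add] at h
  rw [h, card_linear_roots (mul_ne_zero (Ring.two_ne_zero hK) hs)]
  simp

theorem tracePairCount_even_of_ne_zero (hμ : (Module.finrank K L : K) ≠ 0) (s t : K) :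
    (tracePairCount K L s t : ℤ) = (Fintype.card K : ℤ) ^ (2 * j + 2) -
      ε * (Fintype.card K : ℤ) ^ (j + 1) * quadraticChar K (s ^ 2 - Module.finrank K L * t) := by
  rw [tracePairCount_even hK hm hε s t, card_quadratic_roots hK hμ, add_sub_cancel_right,
    ← quadraticChar_four_mul hK (s ^ 2 - _)]
  congr 3
  ring

variable {a : L} (ha : a ∉ Set.range (algebraMap K L)) {s t : K} (hs : Algebra.trace K L a = s)
  (ht : Algebra.trace K L (a ^ 2) = t)
include ha hs ht

theorem sectionCount_even_of_eq_zero_of_eq_zero (hμ : (Module.finrank K L : K) = 0) (hs0 : s = 0)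
    (ρ : K) : (sectionCount a ρ : ℤ) = (Fintype.card K : ℤ) ^ (2 * j + 1) := by
  rw [sectionCount_even hK hm hε ha, hμ, hs, ht, hs0, card_planePoly_zero_zero_roots hK, sub_self,
    mul_zero, sub_zero]

theorem sectionCount_even_of_eq_zero (hμ : (Module.finrank K L : K) = 0) (hs0 : s ≠ 0)
    (ρ : K) : (sectionCount a ρ : ℤ) = (Fintype.card K : ℤ) ^ (2 * j + 1) +
      ε * (Fintype.card K : ℤ) ^ j * (1 - if t = 2 * ρ * s then (Fintype.card K : ℤ) else 0) := by
  rw [sectionCount_even hK hm hε ha, hμ, hs, ht, card_planePoly_zero_roots hK hs0]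
  ring

theorem sectionCount_even_of_disc_eq_zero (hμ : (Module.finrank K L : K) ≠ 0)
    (hD : s ^ 2 - Module.finrank K L * t = 0) (ρ : K) :
    (sectionCount a ρ : ℤ) = (Fintype.card K : ℤ) ^ (2 * j + 1) - ε * (Fintype.card K : ℤ) ^ j *
      if Module.finrank K L * ρ = s then (Fintype.card K : ℤ) else 0 := by
  rw [sectionCount_even hK hm hε ha, hs, ht, card_planePoly_roots_sub_card hK hμ,
    sum_quadraticChar_planeDisc_of_disc_eq_zero hK hD]

theorem sectionCount_even_of_disc_ne_zero (hμ : (Module.finrank K L : K) ≠ 0)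
    (hD : s ^ 2 - Module.finrank K L * t ≠ 0) (ρ : K) :
    (sectionCount a ρ : ℤ) = (Fintype.card K : ℤ) ^ (2 * j + 1) - ε * (Fintype.card K : ℤ) ^ j *
      (quadraticChar K (s ^ 2 - Module.finrank K L * t) *
        if (Module.finrank K L * ρ - s) ^ 2 = s ^ 2 - Module.finrank K L * t
        then (Fintype.card K : ℤ) - 1 else -1) := by
  rw [sectionCount_even hK hm hε ha, hs, ht, card_planePoly_roots_sub_card hK hμ,
    sum_quadraticChar_planeDisc hK hD]

end Even

section Odd

variable (hm : Module.finrank K L = 2 * j + 3) (hε : ε = quadraticChar K (-1) ^ (j + 2))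
include hm hε

theorem tracePairCount_odd_of_eq_zero (hμ : (Module.finrank K L : K) = 0) {s : K} (hs : s ≠ 0)
    (t : K) : (tracePairCount K L s t : ℤ) = (Fintype.card K : ℤ) ^ (2 * j + 1) := by
  have h := tracePairCount_odd hK hm hε s t
  simp only [hμ, neg_zero, zero_mul, zero_add] at h
  rw [h, sum_quadraticChar_linear hK (mul_ne_zero (neg_ne_zero.2 (Ring.two_ne_zero hK)) hs)]
  simp

theorem tracePairCount_odd_of_ne_zero (hμ : (Module.finrank K L : K) ≠ 0) (s t : K) :
    (tracePairCount K L s t : ℤ) = (Fintype.card K : ℤ) ^ (2 * j + 1) +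
      ε * (Fintype.card K : ℤ) ^ j * (quadraticChar K (-Module.finrank K L) *
        if s ^ 2 - Module.finrank K L * t = 0 then (Fintype.card K : ℤ) - 1 else -1) := by
  have h4 := four_ne_zero_of_ringChar_ne_two hK
  rw [tracePairCount_odd hK hm hε s t, sum_quadraticChar_quadratic hK (neg_ne_zero.2 hμ)]
  have : (-2 * s) ^ 2 - 4 * -(Module.finrank K L : K) * -t =
      4 * (s ^ 2 - Module.finrank K L * t) := by ring
  rw [this]
  simp only [mul_eq_zero, h4, false_or]

variable {a : L} (ha : a ∉ Set.range (algebraMap K L)) {s t : K} (hs : Algebra.trace K L a = s)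
  (ht : Algebra.trace K L (a ^ 2) = t)
include ha hs ht

/-- Cancels the factor q left over in `sectionCount_odd`, once the double sum is known to be q times
e. -/
theorem sectionCount_odd_of_sum {ρ : K} {e : ℤ}
    (he : ∑ v : K, ∑ u : K, quadraticChar K (-planePoly (Module.finrank K L : K) s t ρ u v) =
      Fintype.card K * e) :
    (sectionCount a ρ : ℤ) = (Fintype.card K : ℤ) ^ (2 * j) +
      ε * (Fintype.card K : ℤ) ^ j * e := by
  have hq : (Fintype.card K : ℤ) ≠ 0 := by exact_mod_cast Fintype.card_ne_zero
  have h := sectionCount_odd hK hm hε ha ρ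
  rw [hs, ht, he] at h
  refine mul_left_cancel₀ hq ?_
  rw [h]
  ring

theorem sectionCount_odd_of_eq_zero_of_eq_zero (hμ : (Module.finrank K L : K) = 0) (hs0 : s = 0)
    (ρ : K) : (sectionCount a ρ : ℤ) = (Fintype.card K : ℤ) ^ (2 * j) := by
  rw [sectionCount_odd_of_sum hK hm hε ha hs ht (e := 0), mul_zero, add_zero]
  rw [hμ, hs0, sum_quadraticChar_planePoly_zero_zero hK, mul_zero]

theorem sectionCount_odd_of_eq_zero (hμ : (Module.finrank K L : K) = 0) (hs0 : s ≠ 0)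
    (ρ : K) : (sectionCount a ρ : ℤ) = (Fintype.card K : ℤ) ^ (2 * j) +
      ε * (Fintype.card K : ℤ) ^ j * quadraticChar K (2 * ρ * s - t) := by
  rw [sectionCount_odd_of_sum hK hm hε ha hs ht]
  rw [hμ, sum_quadraticChar_planePoly_zero hK hs0]

theorem sectionCount_odd_of_disc_eq_zero (hμ : (Module.finrank K L : K) ≠ 0)
    (hD : s ^ 2 - Module.finrank K L * t = 0) (ρ : K) :
    (sectionCount a ρ : ℤ) = (Fintype.card K : ℤ) ^ (2 * j) + ε * (Fintype.card K : ℤ) ^ j *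
      (quadraticChar K (-Module.finrank K L) * -if Module.finrank K L * ρ = s then 1 else 0) := by
  rw [sectionCount_odd_of_sum hK hm hε ha hs ht]
  rw [sum_quadraticChar_planePoly hK hμ, card_planeDisc_roots_of_disc_eq_zero hK hD]

theorem sectionCount_odd_of_disc_ne_zero (hμ : (Module.finrank K L : K) ≠ 0)
    (hD : s ^ 2 - Module.finrank K L * t ≠ 0) (ρ : K) :
    (sectionCount a ρ : ℤ) = (Fintype.card K : ℤ) ^ (2 * j) + ε * (Fintype.card K : ℤ) ^ j *
      (quadraticChar K (-Module.finrank K L) *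
        quadraticChar K ((Module.finrank K L * ρ - s) ^ 2 - (s ^ 2 - Module.finrank K L * t))) := by
  rw [sectionCount_odd_of_sum hK hm hε ha hs ht]
  rw [sum_quadraticChar_planePoly hK hμ, card_planeDisc_roots hK hD]

end Odd

end Counts

/-! ### Rewriting sums over the nonscalar a as sums over centres, squares and nonsquares. -/

section Reindexing

variable {K : Type*} [Field K] [Fintype K] [DecidableEq K]
variable {L : Type*} [Field L] [Fintype L] [Algebra K L]
variable {A : Type*} [AddCommGroup A]

open Classical in
theorem tracePairCount_eq_add (s t : K) :
    tracePairCount K L s t = #{c : K | Module.finrank K L * c = s ∧ Module.finrank K L * c ^ 2 = t} +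
      #{a : L | a ∉ Set.range (algebraMap K L) ∧
        Algebra.trace K L a = s ∧ Algebra.trace K L (a ^ 2) = t} := by
  rw [tracePairCount, ← card_filter_add_card_filter_not
    (p := fun a => a ∈ Set.range (algebraMap K L))]
  congr 1
  · refine (card_bij (fun c _ => algebraMap K L c) ?_ ?_ ?_).symm
    · intro c hc
      simpa [Algebra.trace_algebraMap, ← map_pow] using hc
    · intro c _ d _ h
      exact (algebraMap K L).injective h
    · intro a ha
      simp only [mem_filter, mem_univ, true_and] at ha
      obtain ⟨⟨h1, h2⟩, c, rfl⟩ := ha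
      refine ⟨c, ?_, rfl⟩
      simpa [Algebra.trace_algebraMap, ← map_pow] using And.intro h1 h2
  · congr 1
    ext a
    simp only [mem_filter, mem_univ, true_and]
    tauto

open Classical in
/-- A function of `Tr a` and `Tr (a ^ 2)` summed over the `a` outside of the base field. -/
theorem sum_nonscalars_eq (G : K → K → A) :
    ∑ a : L with a ∉ Set.range (algebraMap K L), G (Algebra.trace K L a) (Algebra.trace K L (a ^ 2)) =
      ∑ s : K, ∑ t : K, ((tracePairCount K L s t : ℤ) -
        #{c : K | Module.finrank K L * c = s ∧ Module.finrank K L * c ^ 2 = t}) • G s t := by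
  rw [← Fintype.sum_prod_type', ← sum_fiberwise _
    (fun a : L => (Algebra.trace K L a, Algebra.trace K L (a ^ 2)))]
  refine sum_congr rfl fun x _ => ?_
  have h := tracePairCount_eq_add (K := K) (L := L) x.1 x.2
  rw [h, Nat.cast_add, add_sub_cancel_left, natCast_zsmul, ← sum_const, filter_filter]
  refine sum_congr ?_ fun a ha => ?_
  · ext a
    simp [Prod.ext_iff]
  · simp only [mem_filter, mem_univ, true_and] at ha
    rw [← ha.2.1, ← ha.2.2]

theorem card_filter_ne_zero : (#({s | s ≠ 0} : Finset K) : ℤ) = Fintype.card K - 1 := by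
  have he : ({s | s ≠ 0} : Finset K) = univ.erase 0 := by ext; simp
  have h1 : 1 ≤ Fintype.card K := Fintype.card_pos
  rw [he, card_erase_of_mem (mem_univ _), card_univ]
  push_cast [h1]
  rfl

theorem sum_eq_add_sum_ne_zero (f : K → A) : ∑ s, f s = f 0 + ∑ s : K with s ≠ 0, f s := by
  have he : ({s | s ≠ 0} : Finset K) = univ.erase 0 := by ext; simp
  rw [he, add_sum_erase _ _ (mem_univ _)]

open Classical in
theorem card_nonscalars (K L : Type*) [Field K] [Fintype K] [Field L] [Fintype L] [Algebra K L] :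
     (#{a : L | a ∉ Set.range (algebraMap K L)} : ℤ) =
    Fintype.card L - Fintype.card K := by
  have h := card_filter_add_card_filter_not (s := (univ : Finset L))
    (fun a => a ∈ Set.range (algebraMap K L))
  have h2 : #{a : L | a ∈ Set.range (algebraMap K L)} = Fintype.card K := by
    rw [← card_univ, ← card_image_of_injective univ (algebraMap K L).injective]
    congr 1
    ext a
    simp
  rw [h2, card_univ] at h
  rw [← h]
  push_cast
  ring

open Classical in
-- Scalars have trace μc = 0, so the fibres with s ≠ 0 contain none. The fibres with s = 0 are not
-- needed one by one: G is constant on them, and their total size is what remains of the nonscalars.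
theorem sum_nonscalars_of_eq_zero (hK : ringChar K ≠ 2) (hμ : (Module.finrank K L : K) = 0)
    {N : ℤ} (hN : ∀ s : K, s ≠ 0 → ∀ t, (tracePairCount K L s t : ℤ) = N) (G : K → K → A) {G₀ : A}
    (hG : ∀ t, G 0 t = G₀) :
    ∑ a : L with a ∉ Set.range (algebraMap K L), G (Algebra.trace K L a) (Algebra.trace K L (a ^ 2)) =
      ((Fintype.card L : ℤ) - Fintype.card K - (Fintype.card K - 1) * (Fintype.card K * N)) • G₀ +
        ∑ ρ₀ : K, ∑ s : K with s ≠ 0, N • G s (2 * ρ₀ * s) := by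
  have h2 := Ring.two_ne_zero hK
  have hc : ∀ s : K, s ≠ 0 → ∀ t,
      ((tracePairCount K L s t : ℤ) -
        #{c : K | Module.finrank K L * c = s ∧ Module.finrank K L * c ^ 2 = t}) = N := by
    intro s hs t
    simp [hμ, Ne.symm hs, hN s hs]
  -- The constant function 1 yields the total weight, from which the weight of s = 0 is obtained by
  -- subtraction.
  have hone := sum_nonscalars_eq (L := L) (A := ℤ) fun (_ : K) (_ : K) => (1 : ℤ)
  rw [sum_nonscalars_eq]
  rw [sum_const, nsmul_eq_mul, mul_one, card_nonscalars] at hone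
  generalize hw : (fun s t => (tracePairCount K L s t : ℤ) -
    #{c : K | Module.finrank K L * c = s ∧ Module.finrank K L * c ^ 2 = t}) = w at hone ⊢
  replace hw : ∀ s t, (tracePairCount K L s t : ℤ) -
    #{c : K | Module.finrank K L * c = s ∧ Module.finrank K L * c ^ 2 = t} = w s t :=
    fun s t => congrFun (congrFun hw s) t
  simp only [hw] at hc hone ⊢
  rw [sum_eq_add_sum_ne_zero] at hone ⊢
  congr 1
  · simp only [hG]
    rw [← sum_smul]
    congr 1
    rw [sum_congr (s₁ := ({s | s ≠ 0} : Finset K)) rfl (g := fun _ => Fintype.card K * N)] at hone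
    · rw [sum_const, nsmul_eq_mul, card_filter_ne_zero] at hone
      simp only [smul_eq_mul, mul_one] at hone
      linarith
    · intro s hs
      simp [hc s (mem_filter.1 hs).2]
  · rw [sum_comm (s := (univ : Finset K))]
    refine sum_congr rfl fun s hs => ?_
    have hs0 : s ≠ 0 := (mem_filter.1 hs).2
    simp only [hc s hs0]
    -- For fixed s ≠ 0 the value t is traded for the centre ρ₀ with t = 2ρ₀s.
    have hb : Function.Bijective fun ρ₀ : K => 2 * ρ₀ * s :=
      Finite.injective_iff_bijective.1 fun x y h =>
        mul_left_cancel₀ h2 (mul_right_cancel₀ hs0 h)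
    rw [hb.sum_comp fun t => N • G s t]

open Classical in
-- The pair (s, t) is traded for (ρ₀, Δ) = (s/μ, s² - μt). Each fibre with Δ = 0 contains exactly
-- one scalar, namely ρ₀ itself, and the other fibres contain none; hence the weight M 0 - 1.
theorem sum_nonscalars_of_ne_zero (hμ : (Module.finrank K L : K) ≠ 0)
    {M : K → ℤ} (hM : ∀ s t : K, (tracePairCount K L s t : ℤ) = M (s ^ 2 - Module.finrank K L * t))
    {G G' : K → K → A}
    (hG : ∀ s t, G s t = G' (s / Module.finrank K L) (s ^ 2 - Module.finrank K L * t)) :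
    ∑ a : L with a ∉ Set.range (algebraMap K L), G (Algebra.trace K L a) (Algebra.trace K L (a ^ 2)) =
      ∑ ρ₀ : K, (M 0 - 1) • G' ρ₀ 0 + ∑ ρ₀ : K, ∑ Δ : K with Δ ≠ 0, M Δ • G' ρ₀ Δ := by
  rw [sum_nonscalars_eq]
  generalize (Module.finrank K L : K) = μ at *
  have hb : Function.Bijective fun ρ₀ : K => μ * ρ₀ := mulLeft_bijective₀ μ hμ
  rw [← hb.sum_comp, ← sum_add_distrib]
  refine sum_congr rfl fun ρ₀ _ => ?_
  have hb' : Function.Bijective fun Δ : K => ((μ * ρ₀) ^ 2 - Δ) / μ :=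
    Finite.injective_iff_bijective.1 fun x y h => by
      simpa using (div_left_inj' hμ).1 h
  rw [← hb'.sum_comp, sum_eq_add_sum_ne_zero]
  have hΔ : ∀ Δ, (μ * ρ₀) ^ 2 - μ * (((μ * ρ₀) ^ 2 - Δ) / μ) = Δ := fun Δ => by
    rw [mul_div_cancel₀ _ hμ]; ring
  simp only [hM, hG, hΔ, mul_div_cancel_left₀ _ hμ]
  have hc : ∀ Δ : K, #{c : K | μ * c = μ * ρ₀ ∧ μ * c ^ 2 = ((μ * ρ₀) ^ 2 - Δ) / μ} =
      if Δ = 0 then 1 else 0 := by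
    intro Δ
    have : ∀ c : K, (μ * c = μ * ρ₀ ∧ μ * c ^ 2 = ((μ * ρ₀) ^ 2 - Δ) / μ) ↔ (c = ρ₀ ∧ Δ = 0) := by
      intro c
      rw [mul_right_inj' hμ, eq_div_iff hμ]
      refine and_congr_right fun h => ?_
      subst h
      constructor <;> intro h <;> linear_combination h
    simp only [this]
    split_ifs with h <;> simp [h, filter_eq']
  simp only [hc]
  rw [if_pos trivial, Nat.cast_one]
  refine congrArg _ (sum_congr rfl fun Δ h => ?_)
  rw [if_neg (mem_filter.1 h).2, Nat.cast_zero, sub_zero]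

theorem sum_ne_zero_eq_sum_quadraticChar (f : K → A) :
    ∑ Δ : K with Δ ≠ 0, f Δ = ∑ Δ : K with quadraticChar K Δ = 1, f Δ +
      ∑ Δ : K with quadraticChar K Δ = -1, f Δ := by
  rw [← sum_union]
  · refine sum_congr ?_ fun _ _ => rfl
    ext Δ
    simp only [mem_filter, mem_univ, true_and, mem_union]
    constructor
    · exact quadraticChar_dichotomy
    · rintro (h | h) rfl <;> simp at h
  · refine disjoint_filter.2 fun x _ h h' => ?_
    rw [h] at h'
    norm_num at h'

theorem card_quadraticChar_eq (hK : ringChar K ≠ 2) :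
    (#{Δ : K | quadraticChar K Δ = 1} : ℤ) = ((Fintype.card K : ℤ) - 1) / 2 ∧
      (#{Δ : K | quadraticChar K Δ = -1} : ℤ) = ((Fintype.card K : ℤ) - 1) / 2 := by
  have h0 := quadraticChar_sum_zero hK
  rw [sum_eq_add_sum_ne_zero, sum_ne_zero_eq_sum_quadraticChar, quadraticChar_zero, zero_add,
    sum_congr (s₁ := {Δ : K | quadraticChar K Δ = 1}) rfl fun _ h => (mem_filter.1 h).2,
    sum_congr (s₁ := {Δ : K | quadraticChar K Δ = -1}) rfl fun _ h => (mem_filter.1 h).2] at h0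
  have h1 := sum_ne_zero_eq_sum_quadraticChar (K := K) fun _ => (1 : ℤ)
  simp only [sum_const, nsmul_eq_mul, mul_one, card_filter_ne_zero] at h0 h1
  omega

/-- Multiplication by b permutes the nonzero elements, half of which are squares. -/
theorem sum_ne_zero_quadraticChar_mul (hK : ringChar K ≠ 2) {b : K} (hb : b ≠ 0) (f : ℤ → A) :
    ∑ s : K with s ≠ 0, f (quadraticChar K (b * s)) =
      (((Fintype.card K : ℤ) - 1) / 2) • f 1 + (((Fintype.card K : ℤ) - 1) / 2) • f (-1) := by
  have h : ∑ s : K with s ≠ 0, f (quadraticChar K (b * s)) =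
      ∑ s : K with s ≠ 0, f (quadraticChar K s) := by
    refine sum_bijective _ (mulLeft_bijective₀ b hb) (fun s => ?_) fun s _ => rfl
    simp [hb]
  obtain ⟨h1, h2⟩ := card_quadraticChar_eq hK
  rw [h, sum_ne_zero_eq_sum_quadraticChar, ← h1]
  nth_rewrite 2 [h1]
  rw [← h2, natCast_zsmul, natCast_zsmul]
  congr 1
  · exact sum_eq_card_nsmul fun s hs => by rw [(mem_filter.1 hs).2]
  · exact sum_eq_card_nsmul fun s hs => by rw [(mem_filter.1 hs).2]

theorem mem_iff_prod_sub_eq_zero {K : Type*} [Field K] (S : Finset K) (ρ : K) : ρ ∈ S ↔ ∏ σ ∈ S, (ρ - σ) = 0 := by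
  simp [prod_eq_zero_iff, sub_eq_zero]

/-- A pair of a center and a nonzero square is the same as a set of two elements. -/
theorem sum_sum_square_eq_sum_powersetCard (hK : ringChar K ≠ 2) {μ : K} (hμ : μ ≠ 0)
    (f : K → K → A) (g : Finset K → A)
    (hfg : ∀ (S : Finset K) (c Δ : K), (∀ ρ, μ ^ 2 * (ρ - c) ^ 2 - Δ = μ ^ 2 * ∏ σ ∈ S, (ρ - σ)) →
      f c Δ = g S) :
    ∑ c : K, ∑ Δ : K with quadraticChar K Δ = 1, f c Δ = ∑ S ∈ powersetCard 2 univ, g S := by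
  have h2 := Ring.two_ne_zero hK
  rw [← sum_product']
  have key : ∀ S ∈ powersetCard 2 (univ : Finset K), ∀ ρ,
      μ ^ 2 * (ρ - (∑ σ ∈ S, σ) / 2) ^ 2 - μ ^ 2 * (((∑ σ ∈ S, σ) / 2) ^ 2 - ∏ σ ∈ S, σ) =
        μ ^ 2 * ∏ σ ∈ S, (ρ - σ) := by
    intro S hS ρ
    obtain ⟨x, y, hxy, rfl⟩ := card_eq_two.1 (mem_powersetCard.1 hS).2
    rw [sum_pair hxy, prod_pair hxy, prod_pair hxy]
    field_simp
    ring
  -- A set of two roots goes to its midpoint c and to Δ = μ²(c² - product); conversely Δ = d² gives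
  -- the roots c ± d/μ.
  refine (sum_bij (fun S _ => ((∑ σ ∈ S, σ) / 2, μ ^ 2 * (((∑ σ ∈ S, σ) / 2) ^ 2 - ∏ σ ∈ S, σ)))
    ?_ ?_ ?_ ?_).symm
  · intro S hS
    obtain ⟨x, y, hxy, rfl⟩ := card_eq_two.1 (mem_powersetCard.1 hS).2
    rw [sum_pair hxy, prod_pair hxy]
    simp only [mem_product, mem_univ, mem_filter, true_and]
    have : μ ^ 2 * (((x + y) / 2) ^ 2 - x * y) = (μ * (x - y) / 2) ^ 2 := by
      field_simp
      ring
    rw [this]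
    exact quadraticChar_sq_one' (div_ne_zero (mul_ne_zero hμ (sub_ne_zero.2 hxy)) h2)
  -- Equal c and Δ mean equal polynomials, hence equal sets of roots.
  · intro S hS T hT h
    simp only [Prod.mk.injEq] at h
    ext ρ
    have hS' := key S hS ρ
    have hT' := key T hT ρ
    rw [h.1] at hS' h
    rw [h.2, hT'] at hS'
    rw [mem_iff_prod_sub_eq_zero, mem_iff_prod_sub_eq_zero,
      mul_left_cancel₀ (pow_ne_zero 2 hμ) hS']
  · rintro ⟨c, Δ⟩ h
    simp only [mem_product, mem_univ, mem_filter, true_and] at h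
    have hΔ : Δ ≠ 0 := by rintro rfl; simp at h
    obtain ⟨d, hd⟩ := (quadraticChar_one_iff_isSquare hΔ).1 h
    have hd0 : d ≠ 0 := by rintro rfl; simp at hd; exact hΔ hd
    have hne : c + d / μ ≠ c - d / μ := by
      intro h
      have : 2 * d = 0 := by
        field_simp at h
        linear_combination h
      exact (mul_ne_zero h2 hd0) this
    refine ⟨{c + d / μ, c - d / μ}, ?_, ?_⟩
    · rw [mem_powersetCard]
      exact ⟨subset_univ _, card_pair hne⟩
    · rw [sum_pair hne, prod_pair hne, Prod.mk.injEq, hd]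
      constructor
      · field_simp
        ring
      · field_simp
        ring
  · intro S hS
    exact (hfg S _ _ (key S hS)).symm

/-- Patterns record only nonzero symbols, so a pair of roots containing 0 belongs to the family with
a single exceptional symbol ρ₀. -/
theorem sum_powersetCard_two_univ (g : Finset K → A) :
    ∑ S ∈ powersetCard 2 univ, g S = ∑ ρ₀ : K with ρ₀ ≠ 0, g {0, ρ₀} +
      ∑ S ∈ powersetCard 2 ({ρ₀ | ρ₀ ≠ 0} : Finset K), g S := by
  have hu : (univ : Finset K) = insert 0 ({ρ₀ | ρ₀ ≠ 0} : Finset K) := by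
    ext x
    simp [em]
  have h0 : (0 : K) ∉ ({ρ₀ | ρ₀ ≠ 0} : Finset K) := by simp
  conv_lhs => rw [hu]
  rw [powersetCard_succ_insert h0, sum_union, add_comm]
  · congr 1
    rw [sum_image, powersetCard_one, sum_map]
    · rfl
    · intro S hS T hT h
      have hS0 : (0 : K) ∉ S := fun h => h0 ((mem_powersetCard.1 hS).1 h)
      have hT0 : (0 : K) ∉ T := fun h => h0 ((mem_powersetCard.1 hT).1 h)
      rw [← erase_insert hS0, ← erase_insert hT0]
      exact congrArg (fun S => S.erase 0) h
  · rw [disjoint_left]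
    intro S hS hS'
    obtain ⟨T, -, rfl⟩ := mem_image.1 hS'
    exact h0 ((mem_powersetCard.1 hS).1 (mem_insert_self _ _))

end Reindexing

/-! ### Monomials of patterns. -/

section PatternMonomial

variable {p : ℕ} [Fact p.Prime]

theorem patternMonomial_congr (n : ℤ) {N N' : ZMod p → ℤ} (h : ∀ ρ, ρ ≠ 0 → N ρ = N' ρ) :
    patternMonomial n N = patternMonomial n N' := by
  have hs : ∑ ρ with ρ ≠ 0, N ρ = ∑ ρ with ρ ≠ 0, N' ρ :=
    sum_congr rfl fun ρ hρ => h ρ (mem_filter.1 hρ).2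
  rw [patternMonomial, patternMonomial, hs]
  exact congrArg _ (prod_congr rfl fun ρ hρ => by rw [h ρ (mem_filter.1 hρ).2])

/-- In a family indexed by all centres, the member with centre 0 thereby becomes a pattern without
exceptional symbol. -/
theorem patternMonomial_ite_zero (n : ℤ) (A N : ZMod p → ℤ) :
    patternMonomial n (fun ρ => if ρ = 0 then A ρ else N ρ) = patternMonomial n N :=
  patternMonomial_congr n fun _ hρ => if_neg hρ

theorem prod_X_pow_composition {ι : Type*} [Fintype ι] (v : ι → ZMod p) :
    ∏ z, MvPolynomial.X z ^ composition v z =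
      patternMonomial (Fintype.card ι) fun ρ => (composition v ρ : ℤ) := by
  have he : (univ.erase 0 : Finset (ZMod p)) = ({ρ | ρ ≠ 0} : Finset (ZMod p)) := by ext; simp
  have hc : ∑ z, composition v z = Fintype.card ι := by
    rw [← card_univ]
    exact (card_eq_sum_card_fiberwise fun _ _ => mem_coe.2 (mem_univ _)).symm
  rw [← add_sum_erase _ _ (mem_univ (0 : ZMod p)), he] at hc
  rw [← mul_prod_erase _ _ (mem_univ (0 : ZMod p)), he, patternMonomial, ← hc]
  simp

end PatternMonomial

/-! ### From the code to sums over field elements. -/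

section TraceCode

variable {p : ℕ} [Fact p.Prime] {F : Type*} [Field F] [Fintype F] [Algebra (ZMod p) F]

theorem card_definingSet : #(definingSet p F) = tracePairCount (ZMod p) F 1 0 := rfl

theorem composition_traceMap (a : F) (ρ : ZMod p) :
    composition (traceMap p (definingSet p F) a) ρ = sectionCount a ρ := by
  rw [composition, sectionCount, ← filter_filter]
  refine card_bij (fun x _ => x.1) ?_ (fun x _ y _ h => Subtype.ext h) ?_
  · intro x hx
    exact mem_filter.2 ⟨x.2, (mem_filter.1 hx).2⟩
  · intro x hx
    exact ⟨⟨x, (mem_filter.1 hx).1⟩, mem_filter.2 ⟨mem_univ _, (mem_filter.1 hx).2⟩, rfl⟩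

/-- On D one has Tr(cx) = c Tr x = c, so scalars give constant codewords. -/
theorem sectionCount_algebraMap (c ρ : ZMod p) :
    sectionCount (algebraMap (ZMod p) F c) ρ = if ρ = c then #(definingSet p F) else 0 := by
  have h : ∀ x ∈ definingSet p F,
      Algebra.trace (ZMod p) F (algebraMap (ZMod p) F c * x) = ρ ↔ ρ = c := by
    intro x hx
    rw [← Algebra.smul_def, map_smul, (mem_filter.1 hx).2.1, smul_eq_mul, mul_one, eq_comm]
  rw [sectionCount, ← filter_filter]
  change #{x ∈ definingSet p F | _} = _
  rw [filter_congr h]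
  split_ifs with hc <;> simp [hc]

/-- An a in the kernel has N₀ = n. This is excluded outside the base field by `hlt`, and for a
nonzero scalar because its codeword is a nonzero constant of positive length. -/
theorem injective_traceMap (h0 : 0 < #(definingSet p F))
    (hlt : ∀ a : F, a ∉ Set.range (algebraMap (ZMod p) F) →
      sectionCount a (0 : ZMod p) < #(definingSet p F)) :
    Function.Injective (traceMap p (definingSet p F)) := by
  refine (injective_iff_map_eq_zero _).2 fun a ha => ?_
  have hc : sectionCount a (0 : ZMod p) = #(definingSet p F) := by
    rw [← composition_traceMap, ha, composition]
    simp
  by_cases hr : a ∈ Set.range (algebraMap (ZMod p) F)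
  · obtain ⟨c, rfl⟩ := hr
    rw [sectionCount_algebraMap] at hc
    split_ifs at hc with h
    · rw [← h, map_zero]
    · omega
  · exact absurd hc (hlt a hr).ne

theorem hasParameters_traceCode (hinj : Function.Injective (traceMap p (definingSet p F))) :
    HasParameters (traceCode p (definingSet p F)) #(definingSet p F)
      (Module.finrank (ZMod p) F) :=
  ⟨Fintype.card_coe _, LinearMap.finrank_range_of_inj hinj⟩

open Classical in
-- Injectivity lets the sum run over a instead of codewords; the first two terms are the scalars a =
-- 0 and a = ρ₀.
theorem completeWeightEnumerator_traceCode
    (hinj : Function.Injective (traceMap p (definingSet p F))) {n : ℕ}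
    (hn : #(definingSet p F) = n) :
    completeWeightEnumerator (traceCode p (definingSet p F)) =
      patternMonomial n (fun _ => 0) +
      ∑ ρ₀ : ZMod p with ρ₀ ≠ 0, patternMonomial n (fun ρ => if ρ = ρ₀ then (n : ℤ) else 0) +
      ∑ a : F with a ∉ Set.range (algebraMap (ZMod p) F),
        patternMonomial n fun ρ => (sectionCount a ρ : ℤ) := by
  subst hn
  have h1 : completeWeightEnumerator (traceCode p (definingSet p F)) =
      ∑ a : F, patternMonomial #(definingSet p F) fun ρ : ZMod p => (sectionCount a ρ : ℤ) := by
    rw [completeWeightEnumerator]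
    refine (sum_bij (fun a _ => traceMap p (definingSet p F) a) ?_ ?_ ?_ ?_).symm
    · intro a _
      simp [traceCode]
    · exact fun a _ b _ h => hinj h
    · intro c hc
      rw [Set.Finite.mem_toFinset, SetLike.mem_coe] at hc
      obtain ⟨a, ha⟩ := hc
      exact ⟨a, mem_univ _, ha⟩
    · intro a _
      rw [prod_X_pow_composition, Fintype.card_coe]
      simp only [composition_traceMap]
  rw [h1, ← sum_filter_add_sum_filter_not univ (fun a => a ∈ Set.range (algebraMap (ZMod p) F))]
  congr 1
  have h2 : ∑ a : F with a ∈ Set.range (algebraMap (ZMod p) F),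
      patternMonomial #(definingSet p F) (fun ρ : ZMod p => (sectionCount a ρ : ℤ)) =
      ∑ ρ₀ : ZMod p, patternMonomial #(definingSet p F)
        fun ρ => if ρ = ρ₀ then (#(definingSet p F) : ℤ) else 0 := by
    refine (sum_bij (fun c _ => algebraMap (ZMod p) F c) ?_ ?_ ?_ ?_).symm
    · intro c _
      simp
    · exact fun c _ d _ h => (algebraMap (ZMod p) F).injective h
    · intro a ha
      obtain ⟨c, hc⟩ := (mem_filter.1 ha).2
      exact ⟨c, mem_univ _, hc⟩
    · intro c _
      simp [sectionCount_algebraMap]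
  rw [h2, sum_eq_add_sum_ne_zero]
  congr 1
  exact patternMonomial_congr _ fun ρ hρ => if_neg hρ

end TraceCode

/-! ### Enumerators in terms of fibre sizes and section counts; the case of even m with μ = 0. -/

section Cases

variable {p : ℕ} [Fact p.Prime] {F : Type*} [Field F] [Fintype F] [Algebra (ZMod p) F]

theorem ringChar_zmod_ne_two (hp : Odd p) : ringChar (ZMod p) ≠ 2 := by
  rw [ZMod.ringChar_zmod_n]
  rintro rfl
  exact absurd hp (by decide)

theorem quadraticChar_neg_one_pow_eq (k : ℕ) {ε : ℤ}
    (hε : ε = quadraticChar (ZMod p) (-1) ^ k) : ε = 1 ∨ ε = -1 := by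
  rcases quadraticChar_dichotomy (neg_ne_zero.2 (one_ne_zero (α := ZMod p))) with h | h
  · left; rw [hε, h, one_pow]
  · rw [hε, h]; exact neg_one_pow_eq_or ℤ k

theorem card_eq_pow_finrank_int : (Fintype.card F : ℤ) = (p : ℤ) ^ Module.finrank (ZMod p) F := by
  rw [Module.card_eq_pow_finrank (K := ZMod p) (V := F), ZMod.card]
  push_cast
  rfl

open Classical in
theorem enumerator_of_finrank_eq_zero (hp : Odd p)
    (hinj : Function.Injective (traceMap p (definingSet p F))) {n : ℕ}
    (hn : #(definingSet p F) = n) (hμ : (Module.finrank (ZMod p) F : ZMod p) = 0) {N : ℤ}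
    (hN : ∀ s : ZMod p, s ≠ 0 → ∀ t, (tracePairCount (ZMod p) F s t : ℤ) = N)
    {g₀ : ZMod p → ℤ} {g : ZMod p → ZMod p → ZMod p → ℤ}
    (h₀ : ∀ a : F, a ∉ Set.range (algebraMap (ZMod p) F) → Algebra.trace (ZMod p) F a = 0 →
      ∀ ρ : ZMod p, (sectionCount a ρ : ℤ) = g₀ ρ)
    (h : ∀ a : F, a ∉ Set.range (algebraMap (ZMod p) F) → Algebra.trace (ZMod p) F a ≠ 0 →
      ∀ ρ : ZMod p, (sectionCount a ρ : ℤ) =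
        g (Algebra.trace (ZMod p) F a) (Algebra.trace (ZMod p) F (a ^ 2)) ρ) :
    completeWeightEnumerator (traceCode p (definingSet p F)) =
      patternMonomial n (fun _ => 0) +
      ∑ ρ₀ : ZMod p with ρ₀ ≠ 0, patternMonomial n (fun ρ => if ρ = ρ₀ then (n : ℤ) else 0) +
      (((p : ℤ) ^ Module.finrank (ZMod p) F - p - (p - 1) * (p * N)) • patternMonomial n g₀ +
      ∑ ρ₀ : ZMod p, ∑ s : ZMod p with s ≠ 0, N • patternMonomial n (g s (2 * ρ₀ * s))) := by
  rw [completeWeightEnumerator_traceCode hinj hn]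
  have key := sum_nonscalars_of_eq_zero (K := ZMod p) (L := F) (ringChar_zmod_ne_two hp) hμ hN
    (fun s t => patternMonomial n (if s = 0 then g₀ else g s t)) (G₀ := patternMonomial n g₀)
    fun t => by rw [if_pos rfl]
  rw [card_eq_pow_finrank_int (p := p), ZMod.card] at key
  refine congrArg _ (Eq.trans (sum_congr rfl fun a ha => ?_) (key.trans (congrArg _ ?_)))
  · have ha := (mem_filter.1 ha).2
    refine congrArg _ (funext fun ρ => ?_)
    split_ifs with hs
    · exact h₀ a ha hs ρ
    · exact h a ha hs ρ
  · refine sum_congr rfl fun ρ₀ _ => sum_congr rfl fun s hs => ?_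
    rw [if_neg (mem_filter.1 hs).2]

open Classical in
-- The three final sums are Δ = 0, Δ a nonzero square and Δ a nonsquare; c is the centre Tr(a)/μ.
theorem enumerator_of_finrank_ne_zero
    (hinj : Function.Injective (traceMap p (definingSet p F))) {n : ℕ}
    (hn : #(definingSet p F) = n) {μ : ZMod p} (hm : (Module.finrank (ZMod p) F : ZMod p) = μ)
    (hμ : μ ≠ 0) {M : ZMod p → ℤ}
    (hM : ∀ s t : ZMod p, (tracePairCount (ZMod p) F s t : ℤ) = M (s ^ 2 - μ * t))
    {g : ZMod p → ZMod p → ZMod p → ℤ}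
    (h : ∀ a : F, a ∉ Set.range (algebraMap (ZMod p) F) → ∀ ρ c Δ : ZMod p,
      Algebra.trace (ZMod p) F a = μ * c →
      Algebra.trace (ZMod p) F a ^ 2 - μ * Algebra.trace (ZMod p) F (a ^ 2) = Δ →
      (sectionCount a ρ : ℤ) = g c Δ ρ) :
    completeWeightEnumerator (traceCode p (definingSet p F)) =
      patternMonomial n (fun _ => 0) +
      ∑ ρ₀ : ZMod p with ρ₀ ≠ 0, patternMonomial n (fun ρ => if ρ = ρ₀ then (n : ℤ) else 0) +
      (∑ c : ZMod p, (M 0 - 1) • patternMonomial n (g c 0) +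
        (∑ c : ZMod p, ∑ Δ : ZMod p with quadraticChar (ZMod p) Δ = 1,
            M Δ • patternMonomial n (g c Δ) +
          ∑ c : ZMod p, ∑ Δ : ZMod p with quadraticChar (ZMod p) Δ = -1,
            M Δ • patternMonomial n (g c Δ))) := by
  rw [completeWeightEnumerator_traceCode hinj hn]
  have key := sum_nonscalars_of_ne_zero (L := F) (K := ZMod p) (hm ▸ hμ) (hm ▸ hM)
    (G := fun s t => patternMonomial n (g (s / μ) (s ^ 2 - μ * t)))
    (G' := fun c Δ => patternMonomial n (g c Δ)) (by subst hm; exact fun _ _ => rfl)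
  simp only [sum_ne_zero_eq_sum_quadraticChar, sum_add_distrib] at key
  refine congrArg _ (Eq.trans (sum_congr rfl fun a ha => ?_) key)
  refine congrArg _ (funext fun ρ => ?_)
  exact h a (mem_filter.1 ha).2 ρ _ _ (mul_div_cancel₀ _ hμ).symm rfl

variable (hp : Odd p) {j : ℕ} {ε : ℤ} {P : ℤ} (hP : P = (p : ℤ))
include hp hP

theorem three_le_int : 3 ≤ P := by
  rw [hP]
  have h1 := (Fact.out : p.Prime).two_le
  have : p ≠ 2 := by rintro rfl; exact absurd hp (by decide)
  exact_mod_cast (by omega : 3 ≤ p)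

section Even

variable (hm : Module.finrank (ZMod p) F = 2 * j + 4)
  (hε : ε = quadraticChar (ZMod p) (-1) ^ (j + 2))
include hm hε

theorem card_definingSet_even_of_eq_zero (hμ : (Module.finrank (ZMod p) F : ZMod p) = 0) :
    (#(definingSet p F) : ℤ) = P ^ (2 * j + 2) := by
  rw [card_definingSet, tracePairCount_even_of_eq_zero (ringChar_zmod_ne_two hp) hm hε hμ
    one_ne_zero, ZMod.card, hP]

theorem injective_traceMap_even_of_eq_zero (hμ : (Module.finrank (ZMod p) F : ZMod p) = 0) :
    Function.Injective (traceMap p (definingSet p F)) := by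
  have h3 := three_le_int hp hP
  have hQ : 1 ≤ P ^ j := one_le_pow₀ (by linarith)
  have hcard := card_definingSet_even_of_eq_zero hp hP hm hε hμ
  have hε1 := quadraticChar_neg_one_pow_eq _ hε
  have e1 : P ^ (2 * j + 2) = P * P * (P ^ j * P ^ j) := by ring
  have e2 : P ^ (2 * j + 1) = P * (P ^ j * P ^ j) := by ring
  refine injective_traceMap ?_ fun a ha => ?_
  · have : (0 : ℤ) < #(definingSet p F) := by rw [hcard]; positivity
    exact_mod_cast this
  · zify
    rw [hcard, e1]
    by_cases hs : Algebra.trace (ZMod p) F a = 0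
    · rw [sectionCount_even_of_eq_zero_of_eq_zero (ringChar_zmod_ne_two hp) hm hε ha rfl rfl hμ hs,
        ZMod.card, ← hP, e2]
      nlinarith [mul_pos (by linarith : 0 < P ^ j) (by linarith : 0 < P ^ j)]
    · rw [sectionCount_even_of_eq_zero (ringChar_zmod_ne_two hp) hm hε ha rfl rfl hμ hs,
        ZMod.card, ← hP, e2]
      generalize P ^ j = Q at hQ
      have hb : ε * Q * (1 - if Algebra.trace (ZMod p) F (a ^ 2) = 2 * 0 * Algebra.trace (ZMod p) F a
          then P else 0) ≤ (P - 1) * Q := by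
        rcases hε1 with rfl | rfl <;> split_ifs <;> nlinarith
      have hQQ : Q ≤ Q * Q := by nlinarith
      nlinarith [mul_le_mul_of_nonneg_left hQQ (by linarith : 0 ≤ P - 1),
        mul_pos (by nlinarith : 0 < (P - 1) * (P - 1)) (by linarith : 0 < Q * Q)]

theorem enumerator_even_of_eq_zero (hμ : (Module.finrank (ZMod p) F : ZMod p) = 0) {n : ℕ}
    (hn : #(definingSet p F) = n) :
    completeWeightEnumerator (traceCode p (definingSet p F)) =
      patternMonomial n (fun _ => 0)
        + (P ^ (2 * j + 3) - P) • patternMonomial n (fun _ => P ^ (2 * j + 1))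
        + ((P - 1) * P ^ (2 * j + 2)) •
            patternMonomial n (fun _ => P ^ (2 * j + 1) + ε * P ^ j)
        + ∑ ρ₀ : ZMod p with ρ₀ ≠ 0,
            patternMonomial n (fun ρ => if ρ = ρ₀ then P ^ (2 * j + 2) else 0)
        + ∑ ρ₀ : ZMod p with ρ₀ ≠ 0, ((P - 1) * P ^ (2 * j + 2)) •
            patternMonomial n (fun ρ =>
              if ρ = ρ₀ then P ^ (2 * j + 1) - (P - 1) * ε * P ^ j
              else P ^ (2 * j + 1) + ε * P ^ j) := by
  have hK := ringChar_zmod_ne_two hp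
  have hcard := card_definingSet_even_of_eq_zero hp hP hm hε hμ
  rw [enumerator_of_finrank_eq_zero hp (injective_traceMap_even_of_eq_zero hp hP hm hε hμ) hn hμ
    (fun s hs t => tracePairCount_even_of_eq_zero hK hm hε hμ hs t)
    (fun a ha hs ρ => sectionCount_even_of_eq_zero_of_eq_zero hK hm hε ha rfl rfl hμ hs ρ)
    (g := fun s t ρ => (Fintype.card (ZMod p) : ℤ) ^ (2 * j + 1) + ε * (Fintype.card (ZMod p) : ℤ) ^ j *
      (1 - if t = 2 * ρ * s then (Fintype.card (ZMod p) : ℤ) else 0))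
    (fun a ha hs ρ => sectionCount_even_of_eq_zero hK hm hε ha rfl rfl hμ hs ρ)]
  rw [hn] at hcard
  rw [hm, ZMod.card, ← hP]
  have h2 := Ring.two_ne_zero hK
  -- The condition 2ρ₀s = 2ρs is just ρ = ρ₀, so the p - 1 values of s give the same pattern.
  have hg : ∀ ρ₀ : ZMod p, ∑ s : ZMod p with s ≠ 0, (P ^ (2 * j + 2)) • patternMonomial n
      (fun ρ => P ^ (2 * j + 1) + ε * P ^ j * (1 - if 2 * ρ₀ * s = 2 * ρ * s then P else 0)) =
      ((P - 1) * P ^ (2 * j + 2)) • patternMonomial n (fun ρ =>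
        if ρ = ρ₀ then P ^ (2 * j + 1) - (P - 1) * ε * P ^ j
        else P ^ (2 * j + 1) + ε * P ^ j) := by
    intro ρ₀
    rw [sum_eq_card_nsmul (b := P ^ (2 * j + 2) • patternMonomial n (fun ρ =>
        if ρ = ρ₀ then P ^ (2 * j + 1) - (P - 1) * ε * P ^ j
        else P ^ (2 * j + 1) + ε * P ^ j)), ← natCast_zsmul, card_filter_ne_zero, ZMod.card, ← hP,
      mul_smul]
    intro s hs
    congr 2
    ext ρ
    simp only [mul_left_inj' (mem_filter.1 hs).2, mul_right_inj' h2, eq_comm (a := ρ₀)]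
    split_ifs <;> ring
  simp only [hg]
  rw [sum_eq_add_sum_ne_zero, hcard]
  have e : P ^ (2 * j + 4) - P - (P - 1) * (P * P ^ (2 * j + 2)) = P ^ (2 * j + 3) - P := by ring
  rw [e, patternMonomial_ite_zero]
  abel

end Even

end Cases

/-! ### Even m with μ ≠ 0. -/

section EvenNonzero

variable {p : ℕ} [Fact p.Prime] {F : Type*} [Field F] [Fintype F] [Algebra (ZMod p) F]
variable (hp : Odd p) {j : ℕ} {ε : ℤ} {P : ℤ} (hP : P = (p : ℤ))
  (hm : Module.finrank (ZMod p) F = 2 * j + 4)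
  (hε : ε = quadraticChar (ZMod p) (-1) ^ (j + 2))
include hp hP hm hε

theorem card_definingSet_even_of_ne_zero (hμ : (Module.finrank (ZMod p) F : ZMod p) ≠ 0) :
    (#(definingSet p F) : ℤ) = P ^ (2 * j + 2) - ε * P ^ (j + 1) := by
  rw [card_definingSet, tracePairCount_even_of_ne_zero (ringChar_zmod_ne_two hp) hm hε hμ,
    ZMod.card, hP, mul_zero, sub_zero, one_pow, map_one, mul_one]

theorem injective_traceMap_even_of_ne_zero (hμ : (Module.finrank (ZMod p) F : ZMod p) ≠ 0) :
    Function.Injective (traceMap p (definingSet p F)) := by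
  have hK := ringChar_zmod_ne_two hp
  have h3 := three_le_int hp hP
  have hQ : 1 ≤ P ^ j := one_le_pow₀ (by linarith)
  have hcard := card_definingSet_even_of_ne_zero hp hP hm hε hμ
  have hε1 := quadraticChar_neg_one_pow_eq _ hε
  have e1 : P ^ (2 * j + 2) = P * P * (P ^ j * P ^ j) := by ring
  have e2 : P ^ (2 * j + 1) = P * (P ^ j * P ^ j) := by ring
  have e3 : P ^ (j + 1) = P * P ^ j := by ring
  rw [e1, e3] at hcard
  have hQQ : P ^ j ≤ P ^ j * P ^ j := by nlinarith
  refine injective_traceMap ?_ fun a ha => ?_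
  · have : (0 : ℤ) < #(definingSet p F) := by
      rw [hcard]
      generalize P ^ j = Q at *
      have : ε * (P * Q) ≤ P * Q := by rcases hε1 with rfl | rfl <;> nlinarith
      nlinarith [mul_pos (by linarith : 0 < P) (by linarith : 0 < Q),
        mul_pos (by linarith : 0 < P) (by linarith : 0 < Q * Q)]
    exact_mod_cast this
  · zify
    rw [hcard]
    set s := Algebra.trace (ZMod p) F a with hs
    set t := Algebra.trace (ZMod p) F (a ^ 2) with ht
    by_cases hD : s ^ 2 - Module.finrank (ZMod p) F * t = 0
    · rw [sectionCount_even_of_disc_eq_zero hK hm hε ha hs.symm ht.symm hμ hD,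
        ZMod.card, ← hP, e2]
      generalize P ^ j = Q at *
      split_ifs
      · nlinarith [mul_pos (by linarith : 0 < P) (by linarith : 0 < Q * Q)]
      · have : ε * (P * Q) ≤ P * Q := by rcases hε1 with rfl | rfl <;> nlinarith
        have : P * Q ≤ P * (Q * Q) := mul_le_mul_of_nonneg_left hQQ (by linarith)
        nlinarith [mul_pos (by linarith : 0 < P) (by linarith : 0 < Q * Q)]
    · rw [sectionCount_even_of_disc_ne_zero hK hm hε ha hs.symm ht.symm hμ hD,
        ZMod.card, ← hP, e2]
      have hη := quadraticChar_dichotomy hD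
      -- At ρ = 0 a root forces Δ = s², a nonzero square.
      have hsq : (Module.finrank (ZMod p) F * 0 - s) ^ 2 = s ^ 2 - Module.finrank (ZMod p) F * t →
          quadraticChar (ZMod p) (s ^ 2 - Module.finrank (ZMod p) F * t) = 1 := by
        intro h
        rw [← h]
        refine quadraticChar_sq_one' fun h0 => hD ?_
        rw [← h, h0, zero_pow two_ne_zero]
      generalize P ^ j = Q at *
      have hPQ : Q ≤ P * Q := by nlinarith
      have hPQ2 : P * Q ≤ P * (Q * Q) := mul_le_mul_of_nonneg_left hQQ (by linarith)
      have hPPQ : 3 * (P * (Q * Q)) ≤ P * P * (Q * Q) := by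
        nlinarith [mul_pos (by linarith : 0 < P) (by linarith : 0 < Q * Q)]
      split_ifs with h
      · rw [hsq h, one_mul]
        have : ε * Q ≤ Q := by rcases hε1 with rfl | rfl <;> linarith
        have : 0 ≤ ε * Q + Q := by rcases hε1 with rfl | rfl <;> linarith
        nlinarith
      · have : ε * (P * Q) ≤ P * Q := by rcases hε1 with rfl | rfl <;> linarith
        rcases hη with h | h <;> rw [h] <;> rcases hε1 with rfl | rfl <;> nlinarith

theorem enumerator_even_of_ne_zero {μ : ZMod p} (hmμ : (Module.finrank (ZMod p) F : ZMod p) = μ)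
    (hμ : μ ≠ 0) {n : ℕ} (hn : #(definingSet p F) = n) :
    completeWeightEnumerator (traceCode p (definingSet p F)) =
      patternMonomial n (fun _ => 0)
        + (P ^ (2 * j + 2) - 1) • patternMonomial n (fun _ => P ^ (2 * j + 1))
        + ((P - 1) / 2 * (P ^ (2 * j + 3) + ε * P ^ (j + 2))) •
            patternMonomial n (fun _ => P ^ (2 * j + 1) - ε * P ^ j)
        + ∑ ρ₀ : ZMod p with ρ₀ ≠ 0,
            patternMonomial n (fun ρ => if ρ = ρ₀ then (n : ℤ) else 0)
        + ∑ ρ₀ : ZMod p with ρ₀ ≠ 0, (P ^ (2 * j + 2) - 1) •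
            patternMonomial n (fun ρ =>
              if ρ = ρ₀ then P ^ (2 * j + 1) - ε * P ^ (j + 1) else P ^ (2 * j + 1))
        + ∑ ρ₀ : ZMod p with ρ₀ ≠ 0, (n : ℤ) •
            patternMonomial n (fun ρ =>
              if ρ = ρ₀ then P ^ (2 * j + 1) - (P - 1) * ε * P ^ j
              else P ^ (2 * j + 1) + ε * P ^ j)
        + ∑ s ∈ powersetCard 2 {ρ₀ : ZMod p | ρ₀ ≠ 0}, (n : ℤ) •
            patternMonomial n (fun ρ =>
              if ρ ∈ s then P ^ (2 * j + 1) - (P - 1) * ε * P ^ j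
              else P ^ (2 * j + 1) + ε * P ^ j) := by
  have hK := ringChar_zmod_ne_two hp
  have hcard := card_definingSet_even_of_ne_zero hp hP hm hε (hmμ ▸ hμ)
  rw [hn] at hcard
  have hPc : (Fintype.card (ZMod p) : ℤ) = P := by rw [ZMod.card, hP]
  rw [enumerator_of_finrank_ne_zero (injective_traceMap_even_of_ne_zero hp hP hm hε (hmμ ▸ hμ)) hn
    hmμ hμ (M := fun Δ => P ^ (2 * j + 2) - ε * P ^ (j + 1) * quadraticChar (ZMod p) Δ)
    (fun s t => by
      rw [tracePairCount_even_of_ne_zero hK hm hε (hmμ ▸ hμ), hPc, hmμ])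
    (g := fun c Δ ρ => P ^ (2 * j + 1) - ε * P ^ j * if Δ = 0 then (if ρ = c then P else 0) else
      quadraticChar (ZMod p) Δ * if μ ^ 2 * (ρ - c) ^ 2 - Δ = 0 then P - 1 else -1)
    (fun a ha ρ c Δ hs hΔ => by
      split_ifs with h0 h1 h1
      · rw [sectionCount_even_of_disc_eq_zero hK hm hε ha rfl rfl (hmμ ▸ hμ)
          (by rw [hmμ, hΔ, h0]), if_pos (by rw [hmμ, hs, h1]), hPc]
      · rw [sectionCount_even_of_disc_eq_zero hK hm hε ha rfl rfl (hmμ ▸ hμ)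
          (by rw [hmμ, hΔ, h0]), if_neg (by rwa [hmμ, hs, mul_right_inj' hμ]), hPc]
      · rw [sectionCount_even_of_disc_ne_zero hK hm hε ha rfl rfl (hmμ ▸ hμ)
          (by rwa [hmμ, hΔ]), hmμ, hΔ, if_pos (by rw [hs]; linear_combination h1), hPc]
      · rw [sectionCount_even_of_disc_ne_zero hK hm hε ha rfl rfl (hmμ ▸ hμ)
          (by rwa [hmμ, hΔ]), hmμ, hΔ,
          if_neg (fun h => h1 (by rw [hs] at h; linear_combination h)), hPc])]
  -- The frequency for square Δ is n, because D is itself the fibre over s = 1, t = 0, where Δ = 1.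
  have hsq : ∑ c : ZMod p, ∑ Δ : ZMod p with quadraticChar (ZMod p) Δ = 1,
      (P ^ (2 * j + 2) - ε * P ^ (j + 1) * quadraticChar (ZMod p) Δ) • patternMonomial n (fun ρ =>
        P ^ (2 * j + 1) - ε * P ^ j * if Δ = 0 then (if ρ = c then P else 0) else
          quadraticChar (ZMod p) Δ * if μ ^ 2 * (ρ - c) ^ 2 - Δ = 0 then P - 1 else -1) =
      ∑ S ∈ powersetCard 2 (univ : Finset (ZMod p)), (n : ℤ) • patternMonomial n (fun ρ =>
        if ρ ∈ S then P ^ (2 * j + 1) - (P - 1) * ε * P ^ j else P ^ (2 * j + 1) + ε * P ^ j) := by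
    rw [← sum_sum_square_eq_sum_powersetCard hK hμ (fun c Δ => (n : ℤ) • patternMonomial n (fun ρ =>
      if μ ^ 2 * (ρ - c) ^ 2 - Δ = 0 then P ^ (2 * j + 1) - (P - 1) * ε * P ^ j
        else P ^ (2 * j + 1) + ε * P ^ j))]
    · refine sum_congr rfl fun c _ => sum_congr rfl fun Δ hΔ => ?_
      have hΔ := (mem_filter.1 hΔ).2
      have hΔ0 : Δ ≠ 0 := by rintro rfl; simp at hΔ
      rw [hΔ, mul_one, ← hcard]
      congr 2
      ext ρ
      rw [if_neg hΔ0]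
      split_ifs <;> ring
    · intro S c Δ h
      simp only [h, mem_iff_prod_sub_eq_zero S, mul_eq_zero, pow_eq_zero_iff two_ne_zero, hμ,
        false_or]
  have hnsq : ∑ c : ZMod p, ∑ Δ : ZMod p with quadraticChar (ZMod p) Δ = -1,
      (P ^ (2 * j + 2) - ε * P ^ (j + 1) * quadraticChar (ZMod p) Δ) • patternMonomial n (fun ρ =>
        P ^ (2 * j + 1) - ε * P ^ j * if Δ = 0 then (if ρ = c then P else 0) else
          quadraticChar (ZMod p) Δ * if μ ^ 2 * (ρ - c) ^ 2 - Δ = 0 then P - 1 else -1) =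
      ((P - 1) / 2 * (P ^ (2 * j + 3) + ε * P ^ (j + 2))) •
        patternMonomial n (fun _ => P ^ (2 * j + 1) - ε * P ^ j) := by
    -- A nonsquare Δ is never equal to (μ(ρ - c))², so all p(p - 1)/2 pairs (c, Δ) share one
    -- pattern.
    have hc : ∀ c Δ : ZMod p, Δ ∈ ({Δ | quadraticChar (ZMod p) Δ = -1} : Finset (ZMod p)) →
        (P ^ (2 * j + 2) - ε * P ^ (j + 1) * quadraticChar (ZMod p) Δ) • patternMonomial n (fun ρ =>
          P ^ (2 * j + 1) - ε * P ^ j * if Δ = 0 then (if ρ = c then P else 0) else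
            quadraticChar (ZMod p) Δ * if μ ^ 2 * (ρ - c) ^ 2 - Δ = 0 then P - 1 else -1) =
        (P ^ (2 * j + 2) + ε * P ^ (j + 1)) •
          patternMonomial n (fun _ : ZMod p => P ^ (2 * j + 1) - ε * P ^ j) := by
      intro c Δ hΔ
      have hΔ := (mem_filter.1 hΔ).2
      have hΔ0 : Δ ≠ 0 := by rintro rfl; simp at hΔ
      rw [hΔ, mul_neg_one, sub_neg_eq_add]
      congr 2
      ext ρ
      have hne : μ ^ 2 * (ρ - c) ^ 2 - Δ ≠ 0 := fun h =>
        quadraticChar_neg_one_iff_not_isSquare.1 hΔ ⟨μ * (ρ - c), by linear_combination -h⟩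
      rw [if_neg hΔ0, if_neg hne]
      ring
    rw [sum_congr rfl fun c _ => sum_congr rfl (hc c)]
    rw [sum_const, sum_const, card_univ, ← natCast_zsmul, ← natCast_zsmul, smul_smul, smul_smul,
      (card_quadraticChar_eq hK).2, hPc]
    congr 1
    ring
  rw [hsq, hnsq, sum_powersetCard_two_univ, sum_eq_add_sum_ne_zero]
  simp only [if_true, quadraticChar_zero, mul_zero, sub_zero]
  have h1 : ∀ c : ZMod p, patternMonomial n (fun ρ => P ^ (2 * j + 1) -
      ε * P ^ j * if ρ = c then P else 0) = patternMonomial n (fun ρ =>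
        if ρ = c then P ^ (2 * j + 1) - ε * P ^ (j + 1) else P ^ (2 * j + 1)) := by
    intro c
    congr 1
    ext ρ
    split_ifs <;> ring
  have h2 : ∀ c : ZMod p, patternMonomial n (fun ρ => if ρ ∈ ({0, c} : Finset (ZMod p)) then
      P ^ (2 * j + 1) - (P - 1) * ε * P ^ j else P ^ (2 * j + 1) + ε * P ^ j) =
      patternMonomial n (fun ρ => if ρ = c then
        P ^ (2 * j + 1) - (P - 1) * ε * P ^ j else P ^ (2 * j + 1) + ε * P ^ j) := fun c =>
    patternMonomial_congr _ fun ρ hρ => by simp [hρ]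
  simp only [h1, h2, patternMonomial_ite_zero]
  abel

end EvenNonzero

/-! ### Odd m with μ = 0. -/

section OddZero

variable {p : ℕ} [Fact p.Prime] {F : Type*} [Field F] [Fintype F] [Algebra (ZMod p) F]
variable (hp : Odd p) {j : ℕ} {ε : ℤ} {P : ℤ} (hP : P = (p : ℤ))
  (hm : Module.finrank (ZMod p) F = 2 * j + 3)
  (hε : ε = quadraticChar (ZMod p) (-1) ^ (j + 2))
include hp hP hm hε

theorem card_definingSet_odd_of_eq_zero (hμ : (Module.finrank (ZMod p) F : ZMod p) = 0) :
    (#(definingSet p F) : ℤ) = P ^ (2 * j + 1) := by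
  rw [card_definingSet, tracePairCount_odd_of_eq_zero (ringChar_zmod_ne_two hp) hm hε hμ
    one_ne_zero, ZMod.card, hP]

theorem injective_traceMap_odd_of_eq_zero (hμ : (Module.finrank (ZMod p) F : ZMod p) = 0) :
    Function.Injective (traceMap p (definingSet p F)) := by
  have hK := ringChar_zmod_ne_two hp
  have h3 := three_le_int hp hP
  have hQ : 1 ≤ P ^ j := one_le_pow₀ (by linarith)
  have hcard := card_definingSet_odd_of_eq_zero hp hP hm hε hμ
  have hε1 := quadraticChar_neg_one_pow_eq _ hε
  have e1 : P ^ (2 * j + 1) = P * (P ^ j * P ^ j) := by ring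
  have e2 : P ^ (2 * j) = P ^ j * P ^ j := by ring
  have hQQ : P ^ j ≤ P ^ j * P ^ j := by nlinarith
  refine injective_traceMap ?_ fun a ha => ?_
  · have : (0 : ℤ) < #(definingSet p F) := by rw [hcard]; positivity
    exact_mod_cast this
  · zify
    rw [hcard, e1]
    by_cases hs : Algebra.trace (ZMod p) F a = 0
    · rw [sectionCount_odd_of_eq_zero_of_eq_zero hK hm hε ha rfl rfl hμ hs,
        ZMod.card, ← hP, e2]
      nlinarith
    · rw [sectionCount_odd_of_eq_zero hK hm hε ha rfl rfl hμ hs,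
        ZMod.card, ← hP, e2]
      generalize P ^ j = Q at *
      have hb : ε * Q * quadraticChar (ZMod p)
          (2 * 0 * Algebra.trace (ZMod p) F a - Algebra.trace (ZMod p) F (a ^ 2)) ≤ Q := by
        rcases quadraticChar_isQuadratic (ZMod p)
          (2 * 0 * Algebra.trace (ZMod p) F a - Algebra.trace (ZMod p) F (a ^ 2)) with h | h | h <;>
        rw [h] <;> rcases hε1 with rfl | rfl <;> linarith
      nlinarith

theorem enumerator_odd_of_eq_zero (hμ : (Module.finrank (ZMod p) F : ZMod p) = 0) {n : ℕ}
    (hn : #(definingSet p F) = n) {η : ZMod p → ℤ} (hη : η = fun x => quadraticChar (ZMod p) x) :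
    completeWeightEnumerator (traceCode p (definingSet p F)) =
      patternMonomial n (fun _ => 0)
        + (P ^ (2 * j + 2) - P) • patternMonomial n (fun _ => P ^ (2 * j))
        + ((P - 1) / 2 * P ^ (2 * j + 1)) •
            patternMonomial n (fun ρ => P ^ (2 * j) + η ρ * ε * P ^ j)
        + ((P - 1) / 2 * P ^ (2 * j + 1)) •
            patternMonomial n (fun ρ => P ^ (2 * j) - η ρ * ε * P ^ j)
        + ∑ ρ₀ : ZMod p with ρ₀ ≠ 0,
            patternMonomial n (fun ρ => if ρ = ρ₀ then P ^ (2 * j + 1) else 0)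
        + ∑ ρ₀ : ZMod p with ρ₀ ≠ 0, ((P - 1) / 2 * P ^ (2 * j + 1)) •
            patternMonomial n (fun ρ =>
              if ρ = ρ₀ then P ^ (2 * j)
              else P ^ (2 * j) + η (ρ - ρ₀) * ε * P ^ j)
        + ∑ ρ₀ : ZMod p with ρ₀ ≠ 0, ((P - 1) / 2 * P ^ (2 * j + 1)) •
            patternMonomial n (fun ρ =>
              if ρ = ρ₀ then P ^ (2 * j)
              else P ^ (2 * j) - η (ρ - ρ₀) * ε * P ^ j) := by
  have hK := ringChar_zmod_ne_two hp
  have h2 := Ring.two_ne_zero hK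
  have hcard := card_definingSet_odd_of_eq_zero hp hP hm hε hμ
  rw [hn] at hcard
  have hPc : (Fintype.card (ZMod p) : ℤ) = P := by rw [ZMod.card, hP]
  rw [enumerator_of_finrank_eq_zero hp (injective_traceMap_odd_of_eq_zero hp hP hm hε hμ) hn hμ
    (N := P ^ (2 * j + 1)) (g₀ := fun _ => P ^ (2 * j))
    (g := fun s t ρ => P ^ (2 * j) + ε * P ^ j * quadraticChar (ZMod p) (2 * ρ * s - t))
    (fun s hs t => by rw [tracePairCount_odd_of_eq_zero hK hm hε hμ hs t, hPc])
    (fun a ha hs ρ => by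
      rw [sectionCount_odd_of_eq_zero_of_eq_zero hK hm hε ha rfl rfl hμ hs ρ, hPc])
    (fun a ha hs ρ => by
      rw [sectionCount_odd_of_eq_zero hK hm hε ha rfl rfl hμ hs ρ, hPc])]
  rw [hm, ← hP]
  have hg : ∀ ρ₀ : ZMod p, ∑ s : ZMod p with s ≠ 0, (P ^ (2 * j + 1)) • patternMonomial n
      (fun ρ => P ^ (2 * j) + ε * P ^ j * quadraticChar (ZMod p) (2 * ρ * s - 2 * ρ₀ * s)) =
      ((P - 1) / 2 * P ^ (2 * j + 1)) • patternMonomial n (fun ρ =>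
        P ^ (2 * j) + η (ρ - ρ₀) * ε * P ^ j) +
      ((P - 1) / 2 * P ^ (2 * j + 1)) • patternMonomial n (fun ρ =>
        P ^ (2 * j) - η (ρ - ρ₀) * ε * P ^ j) := by
    intro ρ₀
    -- Here 2ρs - 2ρ₀s = 2s(ρ - ρ₀), and the sign e = η(2s) takes each of the values 1 and -1 for
    -- half of the s.
    have h := sum_ne_zero_quadraticChar_mul hK h2 fun e : ℤ =>
      (P ^ (2 * j + 1)) • patternMonomial n
        fun ρ : ZMod p => P ^ (2 * j) + e * η (ρ - ρ₀) * ε * P ^ j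
    rw [hPc, smul_smul, smul_smul] at h
    simp only [one_mul, neg_mul, ← sub_eq_add_neg] at h
    rw [← h]
    refine sum_congr rfl fun s _ => ?_
    congr 2
    ext ρ
    have : 2 * ρ * s - 2 * ρ₀ * s = 2 * s * (ρ - ρ₀) := by ring
    rw [this, map_mul, hη]
    ring
  -- The separate value at ρ = c is automatic because η(0) = 0.
  have hite : ∀ (c : ZMod p) (e : ℤ),
      (fun ρ => if ρ = c then P ^ (2 * j) else P ^ (2 * j) + e * η (ρ - c) * ε * P ^ j) =
      fun ρ => P ^ (2 * j) + e * η (ρ - c) * ε * P ^ j := by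
    intro c e
    ext ρ
    split_ifs with h
    · simp [h, hη]
    · rfl
  have hite1 := fun c => hite c 1
  have hite2 := fun c => hite c (-1)
  simp only [one_mul, neg_mul, ← sub_eq_add_neg] at hite1 hite2
  simp only [hg]
  rw [sum_eq_add_sum_ne_zero, sum_add_distrib, hcard]
  simp only [sub_zero, hite1, hite2]
  have e : P ^ (2 * j + 3) - P - (P - 1) * (P * P ^ (2 * j + 1)) = P ^ (2 * j + 2) - P := by ring
  rw [e]
  abel

end OddZero

/-! ### Odd m with μ ≠ 0. -/

section OddNonzero

variable {p : ℕ} [Fact p.Prime] {F : Type*} [Field F] [Fintype F] [Algebra (ZMod p) F]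
variable (hp : Odd p) {j : ℕ} {ε : ℤ} {P : ℤ} (hP : P = (p : ℤ))
  (hm : Module.finrank (ZMod p) F = 2 * j + 3)
  (hε : ε = quadraticChar (ZMod p) (-1) ^ (j + 2))
include hp hP hm hε

theorem card_definingSet_odd_of_ne_zero (hμ : (Module.finrank (ZMod p) F : ZMod p) ≠ 0) :
    (#(definingSet p F) : ℤ) = P ^ (2 * j + 1) -
      quadraticChar (ZMod p) (-Module.finrank (ZMod p) F) * ε * P ^ j := by
  rw [card_definingSet, tracePairCount_odd_of_ne_zero (ringChar_zmod_ne_two hp) hm hε hμ,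
    ZMod.card, hP, if_neg (by simp)]
  ring

theorem injective_traceMap_odd_of_ne_zero (hμ : (Module.finrank (ZMod p) F : ZMod p) ≠ 0) :
    Function.Injective (traceMap p (definingSet p F)) := by
  have hK := ringChar_zmod_ne_two hp
  have h3 := three_le_int hp hP
  have hQ : 1 ≤ P ^ j := one_le_pow₀ (by linarith)
  have hcard := card_definingSet_odd_of_ne_zero hp hP hm hε hμ
  have hε1 := quadraticChar_neg_one_pow_eq _ hε
  have hη := quadraticChar_dichotomy (neg_ne_zero.2 hμ)
  have e1 : P ^ (2 * j + 1) = P * (P ^ j * P ^ j) := by ring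
  have e2 : P ^ (2 * j) = P ^ j * P ^ j := by ring
  have hQQ : P ^ j ≤ P ^ j * P ^ j := by nlinarith
  -- This would fail only for p = m = 3, where μ = 0.
  have hlarge : 2 < (P - 1) * P ^ j := by
    rcases Nat.eq_zero_or_pos j with rfl | hj
    · have : P ≠ 3 := by
        intro h
        rw [hP] at h
        have hp3 : p = 3 := by exact_mod_cast h
        refine hμ ?_
        rw [hm, mul_zero, zero_add]
        subst hp3
        rfl
      have : 4 ≤ P := by omega
      rw [pow_zero]
      linarith
    · have : P ≤ P ^ j := le_self_pow₀ (by linarith) hj.ne'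
      nlinarith
  have hbig : P ^ j * P ^ j + 2 * P ^ j < P * (P ^ j * P ^ j) := by
    nlinarith [mul_lt_mul_of_pos_right hlarge (by linarith : 0 < P ^ j)]
  have hcard_ge : P * (P ^ j * P ^ j) - P ^ j ≤ #(definingSet p F) := by
    rw [hcard, e1]
    rcases hη with h | h <;> rw [h] <;> rcases hε1 with rfl | rfl <;> linarith
  refine injective_traceMap ?_ fun a ha => ?_
  · have : (0 : ℤ) < #(definingSet p F) := by nlinarith
    exact_mod_cast this
  · zify
    refine lt_of_le_of_lt (b := P ^ j * P ^ j + P ^ j) ?_ (by linarith)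
    set s := Algebra.trace (ZMod p) F a with hs
    set t := Algebra.trace (ZMod p) F (a ^ 2) with ht
    by_cases hD : s ^ 2 - Module.finrank (ZMod p) F * t = 0
    · rw [sectionCount_odd_of_disc_eq_zero hK hm hε ha hs.symm ht.symm hμ hD,
        ZMod.card, ← hP, e2]
      refine add_le_add_right ?_ _
      split_ifs <;> rcases hη with h | h <;> rw [h] <;> rcases hε1 with rfl | rfl <;> linarith
    · rw [sectionCount_odd_of_disc_ne_zero hK hm hε ha hs.symm ht.symm hμ hD,
        ZMod.card, ← hP, e2]
      refine add_le_add_right ?_ _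
      rcases quadraticChar_isQuadratic (ZMod p) ((Module.finrank (ZMod p) F * 0 - s) ^ 2 -
          (s ^ 2 - Module.finrank (ZMod p) F * t)) with h' | h' | h' <;>
        rw [h'] <;> rcases hη with h | h <;> rw [h] <;> rcases hε1 with rfl | rfl <;> linarith

theorem enumerator_odd_of_ne_zero {μ : ZMod p} (hmμ : (Module.finrank (ZMod p) F : ZMod p) = μ)
    (hμ : μ ≠ 0) {n : ℕ} (hn : #(definingSet p F) = n) {η : ZMod p → ℤ}
    (hη : η = fun x => quadraticChar (ZMod p) x) :
    completeWeightEnumerator (traceCode p (definingSet p F)) =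
      patternMonomial n (fun _ => 0)
        + (n + η (-μ) * ε * P ^ (j + 1) - 1) • patternMonomial n (fun _ => P ^ (2 * j))
        + ∑ ρ₀ : ZMod p with ρ₀ ≠ 0,
            patternMonomial n (fun ρ => if ρ = ρ₀ then (n : ℤ) else 0)
        + ∑ ρ₀ : ZMod p with ρ₀ ≠ 0, (n : ℤ) •
            patternMonomial n (fun ρ =>
              if ρ = ρ₀ then P ^ (2 * j)
              else P ^ (2 * j) + η (-μ) * η (ρ ^ 2 - ρ * ρ₀) * ε * P ^ j)
        + ∑ ρ₀ : ZMod p with ρ₀ ≠ 0, (n + η (-μ) * ε * P ^ (j + 1) - 1) •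
            patternMonomial n (fun ρ =>
              if ρ = ρ₀ then P ^ (2 * j) - η (-μ) * ε * P ^ j else P ^ (2 * j))
        + ∑ s ∈ powersetCard 2 {ρ₀ : ZMod p | ρ₀ ≠ 0}, (n : ℤ) •
            patternMonomial n (fun ρ =>
              if ρ ∈ s then P ^ (2 * j)
              else P ^ (2 * j) + η (-μ * ∏ σ ∈ s, (ρ - σ)) * ε * P ^ j)
        + ∑ Δ : ZMod p with η Δ = -1, (n : ℤ) •
            patternMonomial n (fun ρ =>
              P ^ (2 * j) + η (-μ) * η (μ ^ 2 * ρ ^ 2 - Δ) * ε * P ^ j)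
        + ∑ ρ₀ : ZMod p with ρ₀ ≠ 0, ∑ Δ : ZMod p with η Δ = -1, (n : ℤ) •
            patternMonomial n (fun ρ =>
              if ρ = ρ₀ then P ^ (2 * j) - η μ * ε * P ^ j
              else P ^ (2 * j) +
                η (-μ) * η (μ ^ 2 * (ρ - ρ₀) ^ 2 - Δ) * ε * P ^ j) := by
  have hK := ringChar_zmod_ne_two hp
  have hcard := card_definingSet_odd_of_ne_zero hp hP hm hε (hmμ ▸ hμ)
  have hPc : (Fintype.card (ZMod p) : ℤ) = P := by rw [ZMod.card, hP]
  have hηx : ∀ x, quadraticChar (ZMod p) x = η x := fun x => by rw [hη]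
  have hη0 : η 0 = 0 := by simp [hη]
  have hηmul : ∀ x y, η (x * y) = η x * η y := fun x y => by
    rw [hη]
    exact map_mul _ _ _
  have hημ2 : ∀ x, η (μ ^ 2 * x) = η x := fun x => by
    rw [hηmul, ← hηx (μ ^ 2), quadraticChar_sq_one' hμ, one_mul]
  rw [hn, hmμ, hηx] at hcard
  rw [enumerator_of_finrank_ne_zero (injective_traceMap_odd_of_ne_zero hp hP hm hε (hmμ ▸ hμ)) hn
    hmμ hμ (M := fun Δ => P ^ (2 * j + 1) + ε * P ^ j * (η (-μ) * if Δ = 0 then P - 1 else -1))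
    (fun s t => by
      rw [tracePairCount_odd_of_ne_zero hK hm hε (hmμ ▸ hμ), hPc, hmμ, hηx])
    (g := fun c Δ ρ => P ^ (2 * j) + ε * P ^ j * (η (-μ) *
      if Δ = 0 then (-if ρ = c then 1 else 0) else η (μ ^ 2 * (ρ - c) ^ 2 - Δ)))
    (fun a ha ρ c Δ hs hΔ => by
      split_ifs with h0 h1
      · rw [sectionCount_odd_of_disc_eq_zero hK hm hε ha rfl rfl (hmμ ▸ hμ)
          (by rw [hmμ, hΔ, h0]), if_pos (by rw [hmμ, hs, h1]), hPc, hmμ, hηx]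
      · rw [sectionCount_odd_of_disc_eq_zero hK hm hε ha rfl rfl (hmμ ▸ hμ)
          (by rw [hmμ, hΔ, h0]), if_neg (by rwa [hmμ, hs, mul_right_inj' hμ]), hPc, hmμ, hηx]
      · rw [sectionCount_odd_of_disc_ne_zero hK hm hε ha rfl rfl (hmμ ▸ hμ)
          (by rwa [hmμ, hΔ]), hmμ, hΔ, hPc, hηx, hηx, hs]
        congr 4
        ring)]
  simp only [hηx]
  -- For odd m the fibre size depends only on whether Δ = 0, so every Δ ≠ 0 has the frequency n of
  -- the fibre D.
  have hM : P ^ (2 * j + 1) + ε * P ^ j * (η (-μ) * -1) = n := by rw [hcard]; ring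
  have hsq : ∑ c : ZMod p, ∑ Δ : ZMod p with η Δ = 1,
      (P ^ (2 * j + 1) + ε * P ^ j * (η (-μ) * if Δ = 0 then P - 1 else -1)) •
        patternMonomial n (fun ρ => P ^ (2 * j) + ε * P ^ j * (η (-μ) *
          if Δ = 0 then (-if ρ = c then 1 else 0) else η (μ ^ 2 * (ρ - c) ^ 2 - Δ))) =
      ∑ S ∈ powersetCard 2 (univ : Finset (ZMod p)), (n : ℤ) • patternMonomial n (fun ρ =>
        if ρ ∈ S then P ^ (2 * j) else P ^ (2 * j) + η (-μ * ∏ σ ∈ S, (ρ - σ)) * ε * P ^ j) := by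
    rw [← sum_sum_square_eq_sum_powersetCard hK hμ (fun c Δ => (n : ℤ) • patternMonomial n (fun ρ =>
      P ^ (2 * j) + η (-μ) * η (μ ^ 2 * (ρ - c) ^ 2 - Δ) * ε * P ^ j))]
    · simp only [hηx]
      refine sum_congr rfl fun c _ => sum_congr rfl fun Δ hΔ => ?_
      have hΔ0 : Δ ≠ 0 := by rintro rfl; simp [hη0] at hΔ
      rw [if_neg hΔ0, hM]
      congr 2
      ext ρ
      rw [if_neg hΔ0]
      ring
    · intro S c Δ h
      congr 2
      ext ρ
      rw [h, hημ2, hηmul]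
      split_ifs with hρ
      · rw [(mem_iff_prod_sub_eq_zero S ρ).1 hρ, hη0]
        ring
      · rfl
  have hnsq : ∀ c : ZMod p, ∑ Δ : ZMod p with η Δ = -1,
      (P ^ (2 * j + 1) + ε * P ^ j * (η (-μ) * if Δ = 0 then P - 1 else -1)) •
        patternMonomial n (fun ρ => P ^ (2 * j) + ε * P ^ j * (η (-μ) *
          if Δ = 0 then (-if ρ = c then 1 else 0) else η (μ ^ 2 * (ρ - c) ^ 2 - Δ))) =
      ∑ Δ : ZMod p with η Δ = -1, (n : ℤ) • patternMonomial n (fun ρ =>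
        if ρ = c then P ^ (2 * j) - η μ * ε * P ^ j
        else P ^ (2 * j) + η (-μ) * η (μ ^ 2 * (ρ - c) ^ 2 - Δ) * ε * P ^ j) := by
    intro c
    refine sum_congr rfl fun Δ hΔ => ?_
    have hΔ1 := (mem_filter.1 hΔ).2
    have hΔ0 : Δ ≠ 0 := by rintro rfl; simp [hη0] at hΔ
    rw [if_neg hΔ0, hM]
    congr 2
    ext ρ
    rw [if_neg hΔ0]
    split_ifs with h
    -- At the centre the product is η(μΔ), and Δ is a nonsquare.
    · have : η (-μ) * η (μ ^ 2 * (ρ - c) ^ 2 - Δ) = -η μ := by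
        rw [← hηmul, h]
        have : -μ * (μ ^ 2 * (c - c) ^ 2 - Δ) = μ * Δ := by ring
        rw [this, hηmul, hΔ1, mul_neg_one]
      rw [this]
      ring
    · ring
  rw [hsq, sum_congr rfl fun c _ => hnsq c, sum_powersetCard_two_univ,
    sum_eq_add_sum_ne_zero (fun c => ∑ Δ : ZMod p with η Δ = -1, _), sum_eq_add_sum_ne_zero]
  have hM0 : P ^ (2 * j + 1) + ε * P ^ j * (η (-μ) * (P - 1)) - 1 =
      n + η (-μ) * ε * P ^ (j + 1) - 1 := by rw [hcard]; ring
  simp only [if_true, hM0]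
  have h1 : ∀ c : ZMod p, patternMonomial n (fun ρ => P ^ (2 * j) + ε * P ^ j * (η (-μ) *
      -if ρ = c then 1 else 0)) = patternMonomial n (fun ρ =>
        if ρ = c then P ^ (2 * j) - η (-μ) * ε * P ^ j else P ^ (2 * j)) := by
    intro c
    congr 1
    ext ρ
    split_ifs <;> ring
  have h2 : ∀ c ∈ ({c | c ≠ 0} : Finset (ZMod p)), (n : ℤ) • patternMonomial n (fun ρ =>
      if ρ ∈ ({0, c} : Finset (ZMod p)) then P ^ (2 * j)
        else P ^ (2 * j) + η (-μ * ∏ σ ∈ {0, c}, (ρ - σ)) * ε * P ^ j) =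
      (n : ℤ) • patternMonomial n (fun ρ => if ρ = c then P ^ (2 * j)
        else P ^ (2 * j) + η (-μ) * η (ρ ^ 2 - ρ * c) * ε * P ^ j) := by
    intro c hc
    refine congrArg _ (patternMonomial_congr _ fun ρ hρ => ?_)
    have hprod : -μ * ∏ σ ∈ {0, c}, (ρ - σ) = -μ * (ρ ^ 2 - ρ * c) := by
      rw [prod_pair (mem_filter.1 hc).2.symm]
      ring
    rw [hprod, hηmul]
    simp [hρ]
  rw [sum_congr rfl h2]
  simp only [h1, patternMonomial_ite_zero, sub_zero]
  abel

end OddNonzero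

/-! ### The sign ε and the assembly of the four cases. -/

/-- Euler's criterion η(-1) = (-1)^((p-1)/2). The number 2j + 4 is m for even m and m + 1 for odd m,
so both parities use the same exponent j + 2. -/
theorem neg_one_pow_eq_quadraticChar_pow {p : ℕ} [Fact p.Prime] (hp : Odd p) (j : ℕ) :
    (-1 : ℤ) ^ ((p - 1) * (2 * j + 4) / 4) = quadraticChar (ZMod p) (-1) ^ (j + 2) := by
  obtain ⟨k, hk⟩ := hp
  have h1 : (p - 1) * (2 * j + 4) / 4 = k * (j + 2) := by
    rw [hk, Nat.add_sub_cancel, show 2 * k * (2 * j + 4) = k * (j + 2) * 4 by ring]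
    exact Nat.mul_div_cancel _ (by norm_num)
  have h2 : p / 2 = k := by omega
  rw [quadraticChar_neg_one (ringChar_zmod_ne_two ⟨k, hk⟩), ZMod.card,
    ZMod.χ₄_eq_neg_one_pow (by omega), h2, h1, pow_mul]

theorem exists_eq_two_mul_add_four {m : ℕ} (hm : 2 < m) (he : Even m) : ∃ j, m = 2 * j + 4 := by
  obtain ⟨k, hk⟩ := he
  exact ⟨k - 2, by omega⟩

theorem exists_eq_two_mul_add_three {m : ℕ} (hm : 2 < m) (ho : Odd m) : ∃ j, m = 2 * j + 3 := by
  obtain ⟨k, hk⟩ := ho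
  exact ⟨k - 1, by omega⟩

theorem mainTheorem1 (p m : ℕ) [Fact p.Prime] (hp : Odd p) (hm : 2 < m)
    (F : Type*) [Field F] [Fintype F] [Algebra (ZMod p) F] (hF : Fintype.card F = p ^ m)
    (P : ℤ) (hP : P = (p : ℤ))
    (C : Submodule (ZMod p) (definingSet p F → ZMod p)) (hC : C = traceCode p (definingSet p F))
    (η : ZMod p → ℤ) (hη : η = fun x => quadraticChar (ZMod p) x)
    (mₚ : ZMod p) (hmp : mₚ = (m : ZMod p)) :
    (Even m → mₚ = 0 → ∃ n : ℕ, n = p ^ (m - 2) ∧ HasParameters C n m ∧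
      ∀ ε : ℤ, ε = (-1) ^ ((p - 1) * m / 4) →
      completeWeightEnumerator C =
        patternMonomial n (fun _ => 0)
        + (P ^ (m - 1) - P) • patternMonomial n (fun _ => P ^ (m - 3))
        + ((P - 1) * P ^ (m - 2)) •
            patternMonomial n (fun _ => P ^ (m - 3) + ε * P ^ ((m - 4) / 2))
        + ∑ ρ₀ : ZMod p with ρ₀ ≠ 0,
            patternMonomial n (fun ρ => if ρ = ρ₀ then P ^ (m - 2) else 0)
        + ∑ ρ₀ : ZMod p with ρ₀ ≠ 0, ((P - 1) * P ^ (m - 2)) •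
            patternMonomial n (fun ρ =>
              if ρ = ρ₀ then P ^ (m - 3) - (P - 1) * ε * P ^ ((m - 4) / 2)
              else P ^ (m - 3) + ε * P ^ ((m - 4) / 2))) ∧
    (Even m → mₚ ≠ 0 → ∀ ε : ℤ, ε = (-1) ^ ((p - 1) * m / 4) →
      ∃ n : ℕ, (n : ℤ) = P ^ (m - 2) - ε * P ^ ((m - 2) / 2) ∧ HasParameters C n m ∧
      completeWeightEnumerator C =
        patternMonomial n (fun _ => 0)
        + (P ^ (m - 2) - 1) • patternMonomial n (fun _ => P ^ (m - 3))
        + ((P - 1) / 2 * (P ^ (m - 1) + ε * P ^ (m / 2))) •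
            patternMonomial n (fun _ => P ^ (m - 3) - ε * P ^ ((m - 4) / 2))
        + ∑ ρ₀ : ZMod p with ρ₀ ≠ 0,
            patternMonomial n (fun ρ => if ρ = ρ₀ then (n : ℤ) else 0)
        + ∑ ρ₀ : ZMod p with ρ₀ ≠ 0, (P ^ (m - 2) - 1) •
            patternMonomial n (fun ρ =>
              if ρ = ρ₀ then P ^ (m - 3) - ε * P ^ ((m - 2) / 2) else P ^ (m - 3))
        + ∑ ρ₀ : ZMod p with ρ₀ ≠ 0, (n : ℤ) •
            patternMonomial n (fun ρ =>
              if ρ = ρ₀ then P ^ (m - 3) - (P - 1) * ε * P ^ ((m - 4) / 2)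
              else P ^ (m - 3) + ε * P ^ ((m - 4) / 2))
        + ∑ s ∈ powersetCard 2 {ρ₀ : ZMod p | ρ₀ ≠ 0}, (n : ℤ) •
            patternMonomial n (fun ρ =>
              if ρ ∈ s then P ^ (m - 3) - (P - 1) * ε * P ^ ((m - 4) / 2)
              else P ^ (m - 3) + ε * P ^ ((m - 4) / 2))) ∧
    (Odd m → mₚ = 0 → ∃ n : ℕ, n = p ^ (m - 2) ∧ HasParameters C n m ∧
      ∀ ε : ℤ, ε = (-1) ^ ((p - 1) * (m + 1) / 4) →
      completeWeightEnumerator C =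
        patternMonomial n (fun _ => 0)
        + (P ^ (m - 1) - P) • patternMonomial n (fun _ => P ^ (m - 3))
        + ((P - 1) / 2 * P ^ (m - 2)) •
            patternMonomial n (fun ρ => P ^ (m - 3) + η ρ * ε * P ^ ((m - 3) / 2))
        + ((P - 1) / 2 * P ^ (m - 2)) •
            patternMonomial n (fun ρ => P ^ (m - 3) - η ρ * ε * P ^ ((m - 3) / 2))
        + ∑ ρ₀ : ZMod p with ρ₀ ≠ 0,
            patternMonomial n (fun ρ => if ρ = ρ₀ then P ^ (m - 2) else 0)
        + ∑ ρ₀ : ZMod p with ρ₀ ≠ 0, ((P - 1) / 2 * P ^ (m - 2)) •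
            patternMonomial n (fun ρ =>
              if ρ = ρ₀ then P ^ (m - 3)
              else P ^ (m - 3) + η (ρ - ρ₀) * ε * P ^ ((m - 3) / 2))
        + ∑ ρ₀ : ZMod p with ρ₀ ≠ 0, ((P - 1) / 2 * P ^ (m - 2)) •
            patternMonomial n (fun ρ =>
              if ρ = ρ₀ then P ^ (m - 3)
              else P ^ (m - 3) - η (ρ - ρ₀) * ε * P ^ ((m - 3) / 2))) ∧
    (Odd m → mₚ ≠ 0 → ∀ ε : ℤ, ε = (-1) ^ ((p - 1) * (m + 1) / 4) →
      ∃ n : ℕ, (n : ℤ) = P ^ (m - 2) - η (-mₚ) * ε * P ^ ((m - 3) / 2) ∧ HasParameters C n m ∧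
      completeWeightEnumerator C =
        patternMonomial n (fun _ => 0)
        + (n + η (-mₚ) * ε * P ^ ((m - 1) / 2) - 1) • patternMonomial n (fun _ => P ^ (m - 3))
        + ∑ ρ₀ : ZMod p with ρ₀ ≠ 0,
            patternMonomial n (fun ρ => if ρ = ρ₀ then (n : ℤ) else 0)
        + ∑ ρ₀ : ZMod p with ρ₀ ≠ 0, (n : ℤ) •
            patternMonomial n (fun ρ =>
              if ρ = ρ₀ then P ^ (m - 3)
              else P ^ (m - 3) + η (-mₚ) * η (ρ ^ 2 - ρ * ρ₀) * ε * P ^ ((m - 3) / 2))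
        + ∑ ρ₀ : ZMod p with ρ₀ ≠ 0, (n + η (-mₚ) * ε * P ^ ((m - 1) / 2) - 1) •
            patternMonomial n (fun ρ =>
              if ρ = ρ₀ then P ^ (m - 3) - η (-mₚ) * ε * P ^ ((m - 3) / 2) else P ^ (m - 3))
        + ∑ s ∈ powersetCard 2 {ρ₀ : ZMod p | ρ₀ ≠ 0}, (n : ℤ) •
            patternMonomial n (fun ρ =>
              if ρ ∈ s then P ^ (m - 3)
              else P ^ (m - 3) + η (-mₚ * ∏ σ ∈ s, (ρ - σ)) * ε * P ^ ((m - 3) / 2))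
        + ∑ Δ : ZMod p with η Δ = -1, (n : ℤ) •
            patternMonomial n (fun ρ =>
              P ^ (m - 3) + η (-mₚ) * η (mₚ ^ 2 * ρ ^ 2 - Δ) * ε * P ^ ((m - 3) / 2))
        + ∑ ρ₀ : ZMod p with ρ₀ ≠ 0, ∑ Δ : ZMod p with η Δ = -1, (n : ℤ) •
            patternMonomial n (fun ρ =>
              if ρ = ρ₀ then P ^ (m - 3) - η mₚ * ε * P ^ ((m - 3) / 2)
              else P ^ (m - 3) +
                η (-mₚ) * η (mₚ ^ 2 * (ρ - ρ₀) ^ 2 - Δ) * ε * P ^ ((m - 3) / 2))) := by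
  
  have hrank : Module.finrank (ZMod p) F = m := by
    have h := Module.card_eq_pow_finrank (K := ZMod p) (V := F)
    rw [hF, ZMod.card] at h
    exact (Nat.pow_right_injective (Fact.out : p.Prime).two_le h).symm
  have hrank' : (Module.finrank (ZMod p) F : ZMod p) = mₚ := by rw [hrank, hmp]
  clear hmp
  subst hC
  refine ⟨fun he h0 => ?_, fun he h0 ε hε => ?_, fun ho h0 => ?_, fun ho h0 ε hε => ?_⟩
  · obtain ⟨j, rfl⟩ := exists_eq_two_mul_add_four hm he
    rw [h0] at hrank'
    have hc := card_definingSet_even_of_eq_zero hp hP hrank rfl hrank'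
    have hinj := injective_traceMap_even_of_eq_zero hp hP hrank rfl hrank'
    refine ⟨_, ?_, hrank ▸ hasParameters_traceCode hinj, fun ε hε => ?_⟩
    · rw [hP] at hc
      exact_mod_cast hc
    · rw [neg_one_pow_eq_quadraticChar_pow hp] at hε
      -- Only the halved exponent needs rewriting; the exponents m - 1, m - 2 and m - 3 agree by
      -- computation.
      have hj : (2 * j + 4 - 4) / 2 = j := by omega
      rw [hj]
      exact enumerator_even_of_eq_zero hp hP hrank hε hrank' rfl
  · obtain ⟨j, rfl⟩ := exists_eq_two_mul_add_four hm he
    rw [neg_one_pow_eq_quadraticChar_pow hp] at hε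
    have hc := card_definingSet_even_of_ne_zero hp hP hrank hε (hrank' ▸ h0)
    have hinj := injective_traceMap_even_of_ne_zero hp hP hrank hε (hrank' ▸ h0)
    have hj : (2 * j + 4 - 4) / 2 = j := by omega
    have hj' : (2 * j + 4 - 2) / 2 = j + 1 := by omega
    have hj'' : (2 * j + 4) / 2 = j + 2 := by omega
    rw [hj, hj', hj'']
    exact ⟨_, hc, hrank ▸ hasParameters_traceCode hinj,
      enumerator_even_of_ne_zero hp hP hrank hε hrank' h0 rfl⟩
  · obtain ⟨j, rfl⟩ := exists_eq_two_mul_add_three hm ho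
    rw [h0] at hrank'
    have hc := card_definingSet_odd_of_eq_zero hp hP hrank rfl hrank'
    have hinj := injective_traceMap_odd_of_eq_zero hp hP hrank rfl hrank'
    refine ⟨_, ?_, hrank ▸ hasParameters_traceCode hinj, fun ε hε => ?_⟩
    · rw [hP] at hc
      exact_mod_cast hc
    · have hε := hε.trans (neg_one_pow_eq_quadraticChar_pow hp j)
      have hj : (2 * j + 3 - 3) / 2 = j := by omega
      rw [hj]
      exact enumerator_odd_of_eq_zero hp hP hrank hε hrank' rfl hη
  · obtain ⟨j, rfl⟩ := exists_eq_two_mul_add_three hm ho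
    have hε := hε.trans (neg_one_pow_eq_quadraticChar_pow hp j)
    have hc := card_definingSet_odd_of_ne_zero hp hP hrank hε (hrank' ▸ h0)
    have hinj := injective_traceMap_odd_of_ne_zero hp hP hrank hε (hrank' ▸ h0)
    have hj : (2 * j + 3 - 3) / 2 = j := by omega
    have hj' : (2 * j + 3 - 1) / 2 = j + 1 := by omega
    rw [hj, hj']
    refine ⟨_, ?_, hrank ▸ hasParameters_traceCode hinj,
      enumerator_odd_of_ne_zero hp hP hrank hε hrank' h0 rfl hη⟩
    rw [hc, hrank', hη]
    rfl
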